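/- Let $\mathbb G$ be a homogeneous group: a connected, simply connected real Lie group whose Lie algebra $\mathfrak g$ carries dilations $D_\lambda=\mathrm{Exp}(A\ln\lambda)$, $\lambda>0$, where $A$ is a diagonalisable linear operator on $\mathfrak g$ with positive eigenvalues and each $D_\lambda$ is a Lie algebra morphism. The exponential map $\exp:\mathfrak g\to\mathbb G$ is a global diffeomorphism, and the dilations $x\mapsto\lambda x:=\exp(D_\lambda\exp^{-1}x)$ are automorphisms of $\mathbb G$. Let $Q=\mathrm{Tr}\,A$ be the homogeneous dimension, $dx$ a Haar measure, and $|\cdot|$ a homogeneous quasi-norm, i.e. a continuous function $\mathbb G\to[0,\infty)$ with $|x^{-1}|=|x|$, $|\lambda x|=\lambda|x|$ for $\lambda>0$, and $|x|=0$ iff $x=e$. Write $B(x,r)=\{y\in\mathbb G:|xy^{-1}|<r\}$. For $1\le p<\infty$ and $\phi:(0,\infty)\to(0,\infty)$, the generalised Morrey space $L^{p,\phi}(\mathbb G)$ consists of all $f\in L^p_{loc}(\mathbb G)$ (complex valued) with $$\|f\|_{L^{p,\phi}(\mathbb G)}:=\sup_{x\in\mathbb G,\ r>0}\frac1{\phi(r)}\left(\frac1{r^Q}\int_{B(x,r)}|f(y)|^p\,dy\right)^{1/p}<\infty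 .$$ A function $\rho:(0,\infty)\to(0,\infty)$ is doubling if there is a constant $C_\rho>0$ such that $\frac12\le\frac rs\le2$ implies $\frac1{C_\rho}\le\frac{\rho(r)}{\rho(s)}\le C_\rho$. Theorem. Let $1<p<q<\infty$ and let $\rho,\phi:(0,\infty)\to(0,\infty)$ be measurable and doubling. Let $\phi$ be surjective onto $(0,\infty)$, and suppose that for all $r>0$ $$\int_r^\infty\frac{\phi(t)^p}{t}\,dt\le C_1\,\phi(r)^p$$ and $$\phi(r)\int_0^r\frac{\rho(t)}{t}\,dt+\int_r^\infty\frac{\rho(t)\phi(t)}{t}\,dt\le C_2\,\phi(r)^{p/q}.$$ Then for every $f\in L^{p,\phi}(\mathbb G)$ the integral $$T_\rho f(x)=\int_{\mathbb G}\frac{\rho(|xy^{-1}|)}{|xy^{-1}|^{Q}}\,f(y)\,dy$$ converges absolutely for almost every $x\in\mathbb G$, the function $T_\rho f$ belongs to $L^{q,\phi^{p/q}}(\mathbb G)$, and $$\|T_\rho f\|_{L^{q,\phi^{p/q}}(\mathbb G)}\le C\,\|f\|_{L^{p,\phi}(\mathbb G)},$$ where $C>0$ depends only on $\mathbb G$ with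 its dilations, quasi-norm and Haar measure, on $p$, $q$, $\phi$, and on the constants $C_\rho$ and $C_2$ in the hypotheses on $\rho$; it does not depend on $f$, nor on $\rho$ otherwise. -/

import Mathlib

open scoped Manifold ContDiff ENNReal
open MeasureTheory

/-- The bracket of the Lie algebra `GroupLieAlgebra 𝓘(ℝ, E) G` of a Lie group `G`. This Lie algebra
is the tangent space of `G` at the identity, whose underlying vector space is the model space `E`. -/
noncomputable def groupBracket (E G : Type*)
    [NormedAddCommGroup E] [NormedSpace ℝ E] [TopologicalSpace G] [ChartedSpace E G] [Group G]
    (X Y : GroupLieAlgebra 𝓘(ℝ, E) G) : GroupLieAlgebra 𝓘(ℝ, E) G :=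
  ⁅X, Y⁆

/-- The dilation `D_λ = Exp (A ln λ)` generated by `A`, for `λ > 0`. -/
noncomputable def dilation {E : Type*} [NormedAddCommGroup E] [NormedSpace ℝ E]
    (A : E →L[ℝ] E) (l : ℝ) : E →L[ℝ] E :=
  NormedSpace.exp (Real.log l • A)

/-- Dilations on a real Lie group `G`, making it a homogeneous group. -/
structure HomogeneousGroup (E G : Type*) [NormedAddCommGroup E] [NormedSpace ℝ E]
    [TopologicalSpace G] [ChartedSpace E G] [Group G] where
  /-- the generator `A` of the dilations of the Lie algebra -/
  A : E →L[ℝ] E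
  /-- `A` is diagonalisable, with positive eigenvalues -/
  A_diag : ∃ (b : Module.Basis (Fin (Module.finrank ℝ E)) ℝ E)
    (v : Fin (Module.finrank ℝ E) → ℝ), ∀ i, 0 < v i ∧ A (b i) = v i • b i
  /-- every `D_λ`, `λ > 0`, is a morphism of the Lie algebra -/
  dilation_bracket : ∀ l : ℝ, 0 < l → ∀ X Y : E,
    dilation A l (groupBracket E G X Y) = groupBracket E G (dilation A l X) (dilation A l Y)
  /-- the exponential map, a global diffeomorphism from the Lie algebra onto `G` -/
  expMap : Diffeomorph 𝓘(ℝ, E) 𝓘(ℝ, E) E G ∞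
  /-- `t ↦ exp (t X)` is a one-parameter subgroup -/
  expMap_add : ∀ (s t : ℝ) (X : E), expMap ((s + t) • X) = expMap (s • X) * expMap (t • X)
  /-- `t ↦ exp (t X)` has velocity `X` at the identity -/
  mfderiv_expMap : ∀ X : E, (mfderiv 𝓘(ℝ, E) 𝓘(ℝ, E) expMap 0 X : E) = X
  /-- the dilations `exp ∘ D_λ ∘ exp⁻¹` of `G`, `λ > 0`, are group automorphisms -/
  dilation_mul : ∀ l : ℝ, 0 < l → ∀ x y : G,
    expMap (dilation A l (expMap.symm (x * y))) =
      expMap (dilation A l (expMap.symm x)) * expMap (dilation A l (expMap.symm y))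

namespace HomogeneousGroup

variable {E G : Type*} [NormedAddCommGroup E] [NormedSpace ℝ E]
  [TopologicalSpace G] [ChartedSpace E G] [Group G]

/-- The dilation `x ↦ λ x = exp (D_λ (exp⁻¹ x))` of the group, for `λ > 0`. -/
noncomputable def dil (H : HomogeneousGroup E G) (l : ℝ) (x : G) : G :=
  H.expMap (dilation H.A l (H.expMap.symm x))

/-- The homogeneous dimension `Q = Tr A`. -/
noncomputable def Q (H : HomogeneousGroup E G) : ℝ :=
  LinearMap.trace ℝ E (H.A : E →ₗ[ℝ] E)

/-- Homogeneous quasi-norms on the group. -/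
structure IsQuasiNorm (H : HomogeneousGroup E G) (N : G → ℝ) : Prop where
  continuous : Continuous N
  nonneg : ∀ x, 0 ≤ N x
  inv : ∀ x, N x⁻¹ = N x
  dil : ∀ l : ℝ, 0 < l → ∀ x, N (H.dil l x) = l * N x
  eq_zero_iff : ∀ x, N x = 0 ↔ x = 1

end HomogeneousGroup

/-- `ρ : (0, ∞) → (0, ∞)` satisfies the doubling condition with constant `C`:
`1/2 ≤ r/s ≤ 2` implies `1/C ≤ ρ(r)/ρ(s) ≤ C`. -/
def Doubling (C : ℝ) (ρ : ℝ → ℝ) : Prop :=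
  ∀ r s : ℝ, 0 < r → 0 < s → 1 / 2 ≤ r / s → r / s ≤ 2 → 1 / C ≤ ρ r / ρ s ∧ ρ r / ρ s ≤ C

section Morrey

variable {G : Type*} [Group G]

/-- The quasi-ball `{y : |x y⁻¹| < r}` with centre `x` and radius `r`. -/
def quasiBall (N : G → ℝ) (x : G) (r : ℝ) : Set G := {y | N (x * y⁻¹) < r}

variable [MeasurableSpace G]

/-- The generalised Morrey norm
`sup_{x, r > 0} φ(r)⁻¹ (r^{-Q} ∫_{B(x,r)} |f|^p)^{1/p}`, with values in `[0, ∞]`. -/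
noncomputable def morreyNorm (μ : Measure G) (N : G → ℝ) (Q p : ℝ) (φ : ℝ → ℝ) (f : G → ℂ) :
    ℝ≥0∞ :=
  ⨆ (x : G) (r : ℝ) (_ : 0 < r),
    ENNReal.ofReal (1 / φ r) *
      (ENNReal.ofReal (1 / r ^ Q) * ∫⁻ y in quasiBall N x r, ‖f y‖ₑ ^ p ∂μ) ^ (1 / p)

/-- Membership in the generalised Morrey space `L^{p,φ}`: `f ∈ L^p_loc` with finite Morrey norm. -/
def MemMorrey [TopologicalSpace G] (μ : Measure G) (N : G → ℝ) (Q p : ℝ) (φ : ℝ → ℝ)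
    (f : G → ℂ) : Prop :=
  (∀ K : Set G, IsCompact K → MemLp f (ENNReal.ofReal p) (μ.restrict K)) ∧
    morreyNorm μ N Q p φ f < ⊤

/-- The kernel `ρ(|x y⁻¹|) / |x y⁻¹|^Q`. -/
noncomputable def fracKernel (N : G → ℝ) (Q : ℝ) (ρ : ℝ → ℝ) (x y : G) : ℝ :=
  ρ (N (x * y⁻¹)) / N (x * y⁻¹) ^ Q

/-- The generalised fractional integral operator
`T_ρ f(x) = ∫ ρ(|x y⁻¹|) |x y⁻¹|^{-Q} f(y) dy`. -/
noncomputable def fracIntegral (μ : Measure G) (N : G → ℝ) (Q : ℝ) (ρ : ℝ → ℝ) (f : G → ℂ)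
    (x : G) : ℂ :=
  ∫ y, (fracKernel N Q ρ x y : ℂ) * f y ∂μ

end Morrey

/-- The ball of radius `r` around `x` for the distance function `d`. -/
def distBall {X : Type*} (d : X → X → ℝ) (x : X) (r : ℝ) : Set X := {y | d x y < r}

/-- A measurable quasi-metric `d` whose balls of radius `r` have measure `c * r ^ Q`. -/
structure IsRegularQuasiMetric {X : Type*} [MeasurableSpace X] (μ : Measure X) (d : X → X → ℝ)
    (Q K : ℝ) (c : ℝ≥0∞) : Prop where
  measurable : Measurable (Function.uncurry d)
  nonneg : ∀ x y, 0 ≤ d x y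
  self : ∀ x, d x x = 0
  symm : ∀ x y, d x y = d y x
  quasi_triangle : ∀ x y z, d x z ≤ K * max (d x y) (d y z)
  one_le : 1 ≤ K
  dim_pos : 0 < Q
  ne_zero : c ≠ 0
  ne_top : c ≠ ⊤
  measure_ball : ∀ x r, 0 < r → μ (distBall d x r) = c * ENNReal.ofReal (r ^ Q)

/-- The maximal function over balls of rational radius. -/
noncomputable def maximalFunction {X : Type*} [MeasurableSpace X] (μ : Measure X) (d : X → X → ℝ)
    (Q : ℝ) (g : X → ℝ≥0∞) (x : X) : ℝ≥0∞ :=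
  ⨆ (r : ℚ) (_ : 0 < r), ENNReal.ofReal (1 / (r : ℝ) ^ Q) * ∫⁻ y in distBall d x r, g y ∂μ

lemma ofReal_mul_ofReal_one_div {a : ℝ} (ha : 0 < a) :
    ENNReal.ofReal a * ENNReal.ofReal (1 / a) = 1 := by
  rw [← ENNReal.ofReal_mul ha.le, mul_one_div_cancel ha.ne', ENNReal.ofReal_one]

namespace IsRegularQuasiMetric

variable {X : Type*} [MeasurableSpace X] {μ : Measure X} {d : X → X → ℝ} {Q K : ℝ} {c : ℝ≥0∞}

lemma measurableSet_ball (h : IsRegularQuasiMetric μ d Q K c) (x : X) (r : ℝ) :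
    MeasurableSet (distBall d x r) :=
  measurableSet_lt (h.measurable.comp measurable_prodMk_left) measurable_const

lemma mem_ball_self (h : IsRegularQuasiMetric μ d Q K c) (x : X) {r : ℝ} (hr : 0 < r) :
    x ∈ distBall d x r := by
  simpa [distBall, h.self x] using hr

lemma measurable_lintegral_ball [SFinite μ] (h : IsRegularQuasiMetric μ d Q K c) {g : X → ℝ≥0∞}
    (hg : Measurable g) (r : ℝ) : Measurable fun x => ∫⁻ y in distBall d x r, g y ∂μ := by
  have hm : Measurable fun z : X × X =>
      ({z : X × X | d z.1 z.2 < r}.indicator (fun z => g z.2) z) :=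
    (hg.comp measurable_snd).indicator (measurableSet_lt h.measurable measurable_const)
  convert hm.lintegral_prod_right' (ν := μ) using 2 with x
  rw [← lintegral_indicator (h.measurableSet_ball x r)]
  rfl

lemma measurable_maximalFunction [SFinite μ] (h : IsRegularQuasiMetric μ d Q K c)
    {g : X → ℝ≥0∞} (hg : Measurable g) : Measurable (maximalFunction μ d Q g) := by
  refine Measurable.iSup fun r => Measurable.iSup fun _ => ?_
  exact (h.measurable_lintegral_ball hg r).const_mul _

lemma lintegral_ball_le (h : IsRegularQuasiMetric μ d Q K c) (g : X → ℝ≥0∞) (x : X) {t : ℝ}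
    (ht : 0 < t) : ∫⁻ y in distBall d x t, g y ∂μ ≤
      ENNReal.ofReal ((2 * t) ^ Q) * maximalFunction μ d Q g x := by
  obtain ⟨r, hr1, hr2⟩ := exists_rat_btwn (show t < 2 * t by linarith)
  have hr0 : (0 : ℝ) < r := ht.trans hr1
  have hrQ : (0 : ℝ) < (r : ℝ) ^ Q := Real.rpow_pos_of_pos hr0 Q
  calc ∫⁻ y in distBall d x t, g y ∂μ
      ≤ ∫⁻ y in distBall d x r, g y ∂μ :=
        lintegral_mono_set fun y (hy : d x y < t) => hy.trans hr1
    _ = ENNReal.ofReal ((r : ℝ) ^ Q) * (ENNReal.ofReal (1 / (r : ℝ) ^ Q) *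
          ∫⁻ y in distBall d x r, g y ∂μ) := by
        rw [← mul_assoc, ofReal_mul_ofReal_one_div hrQ, one_mul]
    _ ≤ ENNReal.ofReal ((2 * t) ^ Q) * maximalFunction μ d Q g x := by
        refine mul_le_mul' (ENNReal.ofReal_le_ofReal
          (Real.rpow_le_rpow hr0.le hr2.le h.dim_pos.le)) ?_
        exact le_iSup₂_of_le r (by exact_mod_cast hr0) le_rfl

/-- The weak type estimate for the truncated maximal function. -/
lemma mul_measure_truncated_le [SFinite μ] (h : IsRegularQuasiMetric μ d Q K c) (g : X → ℝ≥0∞)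
    (s : ℝ≥0∞) (n : ℕ) :
    s * μ {x | ∃ r : ℚ, 0 < r ∧ r ≤ n ∧
        s < ENNReal.ofReal (1 / (r : ℝ) ^ Q) * ∫⁻ y in distBall d x r, g y ∂μ} ≤
      c * ENNReal.ofReal ((2 * K) ^ Q) * ∫⁻ y, g y ∂μ := by
  set S := {x | ∃ r : ℚ, 0 < r ∧ r ≤ n ∧
        s < ENNReal.ofReal (1 / (r : ℝ) ^ Q) * ∫⁻ y in distBall d x r, g y ∂μ} with hS
  have hex : ∀ x, ∃ r : ℚ, x ∈ S → 0 < r ∧ r ≤ n ∧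
      s < ENNReal.ofReal (1 / (r : ℝ) ^ Q) * ∫⁻ y in distBall d x r, g y ∂μ := by
    intro x
    by_cases hx : x ∈ S
    · obtain ⟨r, hr⟩ := hx
      exact ⟨r, fun _ => hr⟩
    · exact ⟨0, fun h => absurd h hx⟩
  choose R hR using hex
  have hR0 : ∀ x ∈ S, (0 : ℝ) < R x := fun x hx => by exact_mod_cast (hR x hx).1
  have hK : 0 < K := zero_lt_one.trans_le h.one_le
  obtain ⟨u, huS, hdisj, hcov⟩ := Vitali.exists_disjoint_subfamily_covering_enlargement
    (fun x => distBall d x (R x)) S (fun x => (R x : ℝ)) 2 one_lt_two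
    (fun x hx => (hR0 x hx).le) n (fun x hx => by exact_mod_cast (hR x hx).2.1)
    (fun x hx => ⟨x, h.mem_ball_self x (hR0 x hx)⟩)
  have hucount : u.Countable := by
    have := Measure.countable_meas_pos_of_disjoint_iUnion (μ := μ)
      (As := fun x : u => distBall d x.1 (R x.1)) (fun x => h.measurableSet_ball _ _)
      (fun x y hxy => hdisj x.2 y.2 (fun e => hxy (Subtype.ext e)))
    have huniv : {x : u | 0 < μ (distBall d x.1 (R x.1))} = Set.univ := by
      refine Set.eq_univ_of_forall fun x => ?_
      have hx := hR0 x.1 (huS x.2)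
      change 0 < μ _
      rw [h.measure_ball _ _ hx]
      exact ENNReal.mul_pos h.ne_zero (ENNReal.ofReal_pos.2 (Real.rpow_pos_of_pos hx Q)).ne'
    rw [huniv] at this
    exact Set.countable_univ_iff.1 this
  have hsub : S ⊆ ⋃ x ∈ u, distBall d x (2 * K * R x) := by
    intro a ha
    obtain ⟨b, hb, ⟨z, hza, hzb⟩, hab⟩ := hcov a ha
    refine Set.mem_iUnion₂.2 ⟨b, hb, ?_⟩
    have hza' : d a z < R a := hza
    have hzb' : d b z < R b := hzb
    have hRb := hR0 b (huS hb)
    have h1 := h.quasi_triangle b z a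
    rw [h.symm z a] at h1
    have h2 : max (d b z) (d a z) < 2 * R b := max_lt (by linarith) (hza'.trans_le hab)
    change d b a < 2 * K * R b
    nlinarith [mul_lt_mul_of_pos_left h2 hK]
  have : Countable u := hucount.to_subtype
  calc s * μ S ≤ s * ∑' x : u, μ (distBall d x.1 (2 * K * R x.1)) := by
        gcongr
        exact (measure_mono hsub).trans (measure_biUnion_le μ hucount _)
    _ = ∑' x : u, s * μ (distBall d x.1 (2 * K * R x.1)) := ENNReal.tsum_mul_left.symm
    _ ≤ ∑' x : u, c * ENNReal.ofReal ((2 * K) ^ Q) * ∫⁻ y in distBall d x.1 (R x.1), g y ∂μ := by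
        refine ENNReal.tsum_le_tsum fun x => ?_
        have hx := hR0 x.1 (huS x.2)
        have hxQ : (0 : ℝ) < (R x.1 : ℝ) ^ Q := Real.rpow_pos_of_pos hx Q
        have hs := (hR x.1 (huS x.2)).2.2.le
        rw [h.measure_ball _ _ (by positivity), Real.mul_rpow (by positivity) hx.le,
          ENNReal.ofReal_mul (by positivity)]
        calc s * (c * (ENNReal.ofReal ((2 * K) ^ Q) * ENNReal.ofReal ((R x.1 : ℝ) ^ Q)))
            = c * ENNReal.ofReal ((2 * K) ^ Q) * (ENNReal.ofReal ((R x.1 : ℝ) ^ Q) * s) := by ring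
          _ ≤ c * ENNReal.ofReal ((2 * K) ^ Q) * (ENNReal.ofReal ((R x.1 : ℝ) ^ Q) *
              (ENNReal.ofReal (1 / (R x.1 : ℝ) ^ Q) *
                ∫⁻ y in distBall d x.1 (R x.1), g y ∂μ)) := by gcongr
          _ = _ := by
            rw [← mul_assoc (ENNReal.ofReal ((R x.1 : ℝ) ^ Q)), ofReal_mul_ofReal_one_div hxQ,
              one_mul]
    _ = c * ENNReal.ofReal ((2 * K) ^ Q) *
          ∫⁻ y in ⋃ x ∈ u, distBall d x (R x), g y ∂μ := by
        rw [ENNReal.tsum_mul_left, lintegral_biUnion hucount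
          (fun x _ => h.measurableSet_ball _ _) hdisj]
    _ ≤ _ := by
        gcongr
        exact Measure.restrict_le_self

/-- The weak type `(1, 1)` estimate for the maximal function. -/
lemma mul_measure_maximalFunction_le [SFinite μ] (h : IsRegularQuasiMetric μ d Q K c)
    (g : X → ℝ≥0∞) (s : ℝ≥0∞) :
    s * μ {x | s < maximalFunction μ d Q g x} ≤
      c * ENNReal.ofReal ((2 * K) ^ Q) * ∫⁻ y, g y ∂μ := by
  have hU : {x | s < maximalFunction μ d Q g x} = ⋃ n : ℕ, {x | ∃ r : ℚ, 0 < r ∧ r ≤ n ∧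
        s < ENNReal.ofReal (1 / (r : ℝ) ^ Q) * ∫⁻ y in distBall d x r, g y ∂μ} := by
    ext x
    simp only [maximalFunction, lt_iSup_iff, Set.mem_ofPred_eq, Set.mem_iUnion]
    constructor
    · rintro ⟨r, hr, hs⟩
      obtain ⟨n, hn⟩ := exists_nat_ge r
      exact ⟨n, r, hr, hn, hs⟩
    · rintro ⟨n, r, hr, -, hs⟩
      exact ⟨r, hr, hs⟩
  have hmono : Monotone fun n : ℕ => {x | ∃ r : ℚ, 0 < r ∧ r ≤ n ∧
        s < ENNReal.ofReal (1 / (r : ℝ) ^ Q) * ∫⁻ y in distBall d x r, g y ∂μ} := by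
    rintro m n hmn x ⟨r, h1, h2, h3⟩
    exact ⟨r, h1, h2.trans (by exact_mod_cast hmn), h3⟩
  rw [hU, hmono.measure_iUnion, ENNReal.mul_iSup]
  exact iSup_le fun n => h.mul_measure_truncated_le g s n

end IsRegularQuasiMetric

/-- The layer cake formula for a power of a single extended nonnegative number. -/
lemma lintegral_layer (a : ℝ≥0∞) {s : ℝ} (hs : 0 < s) :
    ∫⁻ t in Set.Ioi (0 : ℝ), (if ENNReal.ofReal t < a then ENNReal.ofReal (t ^ (s - 1)) else 0) =
      ENNReal.ofReal (1 / s) * a ^ s := by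
  induction a with
  | top =>
    rw [ENNReal.top_rpow_of_pos hs, ENNReal.mul_top (by simpa using hs)]
    by_contra hne
    refine not_integrableOn_Ioi_rpow (s - 1) ⟨by fun_prop, ?_⟩
    rw [hasFiniteIntegral_iff_ofReal (by
      filter_upwards [self_mem_ae_restrict measurableSet_Ioi] with t ht
      exact Real.rpow_nonneg (le_of_lt ht) _)]
    simpa using lt_top_iff_ne_top.2 hne
  | coe a =>
    have h1 : ∀ t ∈ Set.Ioi (0 : ℝ),
        (if ENNReal.ofReal t < (a : ℝ≥0∞) then ENNReal.ofReal (t ^ (s - 1)) else 0) =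
          (Set.Iio (a : ℝ)).indicator (fun t => ENNReal.ofReal (t ^ (s - 1))) t := by
      intro t ht
      have : ENNReal.ofReal t < (a : ℝ≥0∞) ↔ t ∈ Set.Iio (a : ℝ) := by
        rw [ENNReal.ofReal_lt_coe_iff (le_of_lt ht)]
        rfl
      simp only [this, Set.indicator]
    rw [setLIntegral_congr_fun measurableSet_Ioi h1, lintegral_indicator measurableSet_Iio,
      Measure.restrict_restrict measurableSet_Iio, Set.inter_comm, Set.Ioi_inter_Iio,
      restrict_Ioo_eq_restrict_Ioc]
    have hint := (intervalIntegral.intervalIntegrable_rpow' (a := 0) (b := a) (r := s - 1)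
      (by linarith)).1
    rw [← ofReal_integral_eq_lintegral_ofReal hint (by
      filter_upwards [self_mem_ae_restrict measurableSet_Ioc] with t ht
      exact Real.rpow_nonneg ht.1.le _), ← intervalIntegral.integral_of_le a.coe_nonneg,
      integral_rpow (Or.inl (by linarith)), sub_add_cancel, Real.zero_rpow hs.ne', sub_zero,
      div_eq_inv_mul, ← one_div, ENNReal.ofReal_mul (by positivity),
      ← ENNReal.ofReal_rpow_of_nonneg a.coe_nonneg hs.le]
    simp

namespace IsRegularQuasiMetric

variable {X : Type*} [MeasurableSpace X] {μ : Measure X} {d : X → X → ℝ} {Q K : ℝ} {c : ℝ≥0∞}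

lemma maximalFunction_le_add_const (h : IsRegularQuasiMetric μ d Q K c) {g g' : X → ℝ≥0∞}
    (hg' : Measurable g') (b : ℝ≥0∞) (hle : ∀ y, g y ≤ g' y + b) (x : X) :
    maximalFunction μ d Q g x ≤ maximalFunction μ d Q g' x + b * c := by
  refine iSup₂_le fun r hr => ?_
  have hr0 : (0 : ℝ) < r := by exact_mod_cast hr
  have hrQ : (0 : ℝ) < (r : ℝ) ^ Q := Real.rpow_pos_of_pos hr0 Q
  calc ENNReal.ofReal (1 / (r : ℝ) ^ Q) * ∫⁻ y in distBall d x r, g y ∂μ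
      ≤ ENNReal.ofReal (1 / (r : ℝ) ^ Q) * ∫⁻ y in distBall d x r, (g' y + b) ∂μ := by
        gcongr with y
        exact hle y
    _ = ENNReal.ofReal (1 / (r : ℝ) ^ Q) * ∫⁻ y in distBall d x r, g' y ∂μ +
          b * c * (ENNReal.ofReal ((r : ℝ) ^ Q) * ENNReal.ofReal (1 / (r : ℝ) ^ Q)) := by
        rw [lintegral_add_left hg', setLIntegral_const, h.measure_ball _ _ hr0]
        ring
    _ ≤ _ := by
        rw [ofReal_mul_ofReal_one_div hrQ, mul_one]
        gcongr
        exact le_iSup₂_of_le r hr le_rfl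

/-- The weak type estimate with the integral restricted to a superlevel set. -/
lemma measure_maximalFunction_le [SFinite μ] (h : IsRegularQuasiMetric μ d Q K c)
    {g : X → ℝ≥0∞} (hg : Measurable g) {t : ℝ} (ht : 0 < t) :
    μ {x | ENNReal.ofReal t < maximalFunction μ d Q g x} ≤
      ENNReal.ofReal (2 / t) * (c * ENNReal.ofReal ((2 * K) ^ Q)) *
        ∫⁻ y, (if ENNReal.ofReal t < 2 * c * g y then g y else 0) ∂μ := by
  set g' : X → ℝ≥0∞ := fun y => if ENNReal.ofReal t < 2 * c * g y then g y else 0 with hg'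
  have hg'm : Measurable g' :=
    Measurable.ite (measurableSet_lt measurable_const (hg.const_mul _)) hg measurable_const
  have h2c : 2 * c ≠ 0 := mul_ne_zero two_ne_zero h.ne_zero
  have h2ct : 2 * c ≠ ⊤ := ENNReal.mul_ne_top ENNReal.ofNat_ne_top h.ne_top
  have hle : ∀ y, g y ≤ g' y + ENNReal.ofReal t / (2 * c) := by
    intro y
    by_cases hy : ENNReal.ofReal t < 2 * c * g y
    · simp [hg', hy]
    · simp only [hg', hy, if_false, zero_add]
      rw [ENNReal.le_div_iff_mul_le (Or.inl h2c) (Or.inl h2ct), mul_comm]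
      exact not_lt.1 hy
  have hhalf : ENNReal.ofReal t / (2 * c) * c = ENNReal.ofReal (t / 2) := by
    rw [ENNReal.div_eq_inv_mul, ENNReal.mul_inv (Or.inl two_ne_zero) (Or.inl ENNReal.ofNat_ne_top),
      mul_right_comm, mul_assoc 2⁻¹, ENNReal.inv_mul_cancel h.ne_zero h.ne_top, mul_one,
      ENNReal.ofReal_div_of_pos two_pos, ENNReal.div_eq_inv_mul]
    simp
  have hsub : {x | ENNReal.ofReal t < maximalFunction μ d Q g x} ⊆
      {x | ENNReal.ofReal (t / 2) < maximalFunction μ d Q g' x} := by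
    intro x hx
    have h1 := lt_of_lt_of_le hx (h.maximalFunction_le_add_const hg'm _ hle x)
    rw [hhalf] at h1
    by_contra hcon
    refine absurd h1 (not_lt.2 ?_)
    calc maximalFunction μ d Q g' x + ENNReal.ofReal (t / 2)
        ≤ ENNReal.ofReal (t / 2) + ENNReal.ofReal (t / 2) := by
          gcongr
          exact not_lt.1 hcon
      _ = ENNReal.ofReal t := by
          rw [← ENNReal.ofReal_add (by positivity) (by positivity), add_halves]
  calc μ {x | ENNReal.ofReal t < maximalFunction μ d Q g x}
      ≤ μ {x | ENNReal.ofReal (t / 2) < maximalFunction μ d Q g' x} := measure_mono hsub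
    _ = ENNReal.ofReal (2 / t) * (ENNReal.ofReal (t / 2) *
          μ {x | ENNReal.ofReal (t / 2) < maximalFunction μ d Q g' x}) := by
        rw [← mul_assoc, ← ENNReal.ofReal_mul (by positivity),
          show 2 / t * (t / 2) = 1 by field_simp, ENNReal.ofReal_one, one_mul]
    _ ≤ ENNReal.ofReal (2 / t) * (c * ENNReal.ofReal ((2 * K) ^ Q) * ∫⁻ y, g' y ∂μ) := by
        exact mul_le_mul' le_rfl (h.mul_measure_maximalFunction_le g' _)
    _ = _ := by ring

/-- The Hardy–Littlewood maximal theorem: the strong type `(p, p)` estimate. -/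
lemma lintegral_maximalFunction_rpow_le [SFinite μ] (h : IsRegularQuasiMetric μ d Q K c)
    {p : ℝ} (hp : 1 < p) {g : X → ℝ≥0∞} (hg : Measurable g) :
    ∫⁻ x, maximalFunction μ d Q g x ^ p ∂μ ≤
      ENNReal.ofReal p * (2 * (c * ENNReal.ofReal ((2 * K) ^ Q))) *
        (ENNReal.ofReal (1 / (p - 1)) * (2 * c) ^ (p - 1)) * ∫⁻ x, g x ^ p ∂μ := by
  have hp0 : 0 < p := by linarith
  have hM := h.measurable_maximalFunction hg
  have hmeas1 : Measurable (Function.uncurry fun (x : X) (t : ℝ) =>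
      if ENNReal.ofReal t < maximalFunction μ d Q g x then ENNReal.ofReal (t ^ (p - 1)) else 0) :=
    Measurable.ite (measurableSet_lt (by fun_prop) (hM.comp measurable_fst)) (by fun_prop)
      measurable_const
  have hmeas2 : Measurable (Function.uncurry fun (t : ℝ) (x : X) =>
      g x * if ENNReal.ofReal t < 2 * c * g x then ENNReal.ofReal (t ^ (p - 1 - 1)) else 0) :=
    (hg.comp measurable_snd).mul
      (Measurable.ite (measurableSet_lt (by fun_prop) ((hg.comp measurable_snd).const_mul _))
      (by fun_prop) measurable_const)
  set A := c * ENNReal.ofReal ((2 * K) ^ Q) with hA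
  have step1 : ∀ x, maximalFunction μ d Q g x ^ p = ENNReal.ofReal p *
      ∫⁻ t in Set.Ioi (0 : ℝ), (if ENNReal.ofReal t < maximalFunction μ d Q g x then
        ENNReal.ofReal (t ^ (p - 1)) else 0) := by
    intro x
    rw [lintegral_layer _ hp0, ← mul_assoc, ofReal_mul_ofReal_one_div hp0, one_mul]
  have step2 : ∀ t ∈ Set.Ioi (0 : ℝ),
      ∫⁻ x, (if ENNReal.ofReal t < maximalFunction μ d Q g x then
        ENNReal.ofReal (t ^ (p - 1)) else 0) ∂μ ≤
      2 * A * ∫⁻ x, (g x * if ENNReal.ofReal t < 2 * c * g x then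
        ENNReal.ofReal (t ^ (p - 1 - 1)) else 0) ∂μ := by
    intro t (ht : 0 < t)
    calc ∫⁻ x, (if ENNReal.ofReal t < maximalFunction μ d Q g x then
            ENNReal.ofReal (t ^ (p - 1)) else 0) ∂μ
        = ENNReal.ofReal (t ^ (p - 1)) *
            μ {x | ENNReal.ofReal t < maximalFunction μ d Q g x} := by
          rw [← lintegral_indicator_const (measurableSet_lt measurable_const hM)]
          simp only [Set.indicator_apply, Set.mem_ofPred_eq]
      _ ≤ ENNReal.ofReal (t ^ (p - 1)) * (ENNReal.ofReal (2 / t) * A *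
            ∫⁻ y, (if ENNReal.ofReal t < 2 * c * g y then g y else 0) ∂μ) := by
          gcongr
          exact h.measure_maximalFunction_le hg ht
      _ = 2 * A * (ENNReal.ofReal (t ^ (p - 1 - 1)) *
            ∫⁻ y, (if ENNReal.ofReal t < 2 * c * g y then g y else 0) ∂μ) := by
          have e : ENNReal.ofReal (t ^ (p - 1)) * ENNReal.ofReal (2 / t) =
              2 * ENNReal.ofReal (t ^ (p - 1 - 1)) := by
            rw [← ENNReal.ofReal_mul (by positivity), Real.rpow_sub_one ht.ne' (p - 1),
              show t ^ (p - 1) * (2 / t) = 2 * (t ^ (p - 1) / t) by ring,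
              ENNReal.ofReal_mul two_pos.le]
            simp
          calc _ = ENNReal.ofReal (t ^ (p - 1)) * ENNReal.ofReal (2 / t) * A *
                ∫⁻ y, (if ENNReal.ofReal t < 2 * c * g y then g y else 0) ∂μ := by ring
            _ = _ := by rw [e]; ring
      _ = _ := by
          rw [← lintegral_const_mul _ (Measurable.ite
            (measurableSet_lt measurable_const (hg.const_mul _)) hg measurable_const)]
          congr 2 with x
          split_ifs
          · rw [mul_comm]
          · simp
  calc ∫⁻ x, maximalFunction μ d Q g x ^ p ∂μ
      = ENNReal.ofReal p * ∫⁻ x, (∫⁻ t in Set.Ioi (0 : ℝ),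
          (if ENNReal.ofReal t < maximalFunction μ d Q g x then
            ENNReal.ofReal (t ^ (p - 1)) else 0)) ∂μ := by
        rw [lintegral_congr step1, lintegral_const_mul _ hmeas1.lintegral_prod_right]
    _ = ENNReal.ofReal p * ∫⁻ t in Set.Ioi (0 : ℝ), ∫⁻ x,
          (if ENNReal.ofReal t < maximalFunction μ d Q g x then
            ENNReal.ofReal (t ^ (p - 1)) else 0) ∂μ := by
        rw [lintegral_lintegral_swap hmeas1.aemeasurable]
    _ ≤ ENNReal.ofReal p * ∫⁻ t in Set.Ioi (0 : ℝ), 2 * A *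
          ∫⁻ x, (g x * if ENNReal.ofReal t < 2 * c * g x then
            ENNReal.ofReal (t ^ (p - 1 - 1)) else 0) ∂μ := by
        gcongr 1
        exact setLIntegral_mono' measurableSet_Ioi step2
    _ = ENNReal.ofReal p * (2 * A * ∫⁻ x, (∫⁻ t in Set.Ioi (0 : ℝ),
          (g x * if ENNReal.ofReal t < 2 * c * g x then
            ENNReal.ofReal (t ^ (p - 1 - 1)) else 0)) ∂μ) := by
        rw [lintegral_const_mul _ hmeas2.lintegral_prod_right,
          lintegral_lintegral_swap hmeas2.aemeasurable]
    _ = ENNReal.ofReal p * (2 * A * ∫⁻ x, (ENNReal.ofReal (1 / (p - 1)) * (2 * c) ^ (p - 1)) *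
          g x ^ p ∂μ) := by
        congr 3 with x
        rw [lintegral_const_mul _ (Measurable.ite (measurableSet_lt (by fun_prop) measurable_const)
          (by fun_prop) measurable_const), lintegral_layer _ (by linarith),
          ENNReal.mul_rpow_of_nonneg _ _ (by linarith)]
        have e : g x ^ p = g x * g x ^ (p - 1) := by
          conv_rhs => rw [← ENNReal.rpow_one (g x), ← ENNReal.rpow_mul, one_mul]
          rw [← ENNReal.rpow_add_of_nonneg _ _ zero_le_one (by linarith)]
          simp
        rw [e]
        ring
    _ = _ := by
        rw [lintegral_const_mul _ (hg.pow_const p)]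
        ring

end IsRegularQuasiMetric

/-- `g` has generalised Morrey norm at most `b`. -/
def MorreyBound {X : Type*} [MeasurableSpace X] (μ : Measure X) (d : X → X → ℝ) (Q p : ℝ)
    (φ : ℝ → ℝ) (g : X → ℝ≥0∞) (b : ℝ≥0∞) : Prop :=
  ∀ x r, 0 < r → ∫⁻ y in distBall d x r, g y ^ p ∂μ ≤ ENNReal.ofReal (r ^ Q * φ r ^ p) * b ^ p

lemma Doubling.one_le {C : ℝ} {φ : ℝ → ℝ} (h : Doubling C φ)
    (hφ : Set.MapsTo φ (Set.Ioi 0) (Set.Ioi 0)) : 1 ≤ C := by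
  have h1 := (h 1 1 one_pos one_pos (by norm_num) (by norm_num)).2
  rwa [div_self (hφ (show (0 : ℝ) < 1 from one_pos)).ne'] at h1

lemma Doubling.le_mul {C : ℝ} {φ : ℝ → ℝ} (h : Doubling C φ)
    (hφ : Set.MapsTo φ (Set.Ioi 0) (Set.Ioi 0)) {r s : ℝ} (hr : 0 < r) (hs : 0 < s)
    (h1 : s ≤ 2 * r) (h2 : r ≤ 2 * s) : φ r ≤ C * φ s := by
  have h3 := (h r s hr hs (by rw [div_le_div_iff₀ two_pos hs]; linarith)
    (by rw [div_le_iff₀ hs]; exact h2)).2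
  rwa [div_le_iff₀ (hφ hs)] at h3

/-- A doubling function satisfying the integral condition is almost decreasing. -/
lemma Doubling.exists_almost_decreasing {C C₁ p : ℝ} {φ : ℝ → ℝ} (h : Doubling C φ)
    (hφ : Set.MapsTo φ (Set.Ioi 0) (Set.Ioi 0)) (hp : 0 < p)
    (hint : ∀ r : ℝ, 0 < r →
      ∫⁻ t in Set.Ioi r, ENNReal.ofReal (φ t ^ p / t) ≤ ENNReal.ofReal (C₁ * φ r ^ p)) :
    ∃ D : ℝ, 1 ≤ D ∧ ∀ r s, 0 < r → r ≤ s → φ s ≤ D * φ r := by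
  have hC : 1 ≤ C := h.one_le hφ
  have hC0 : 0 < C := by linarith
  refine ⟨max 1 (2 * C ^ p * |C₁|) ^ (1 / p),
    Real.one_le_rpow (le_max_left _ _) (by positivity), fun r s hr hrs => ?_⟩
  have hs : 0 < s := hr.trans_le hrs
  have hφr : 0 < φ r := hφ hr
  have hφs : 0 < φ s := hφ hs
  have key : ENNReal.ofReal (φ s ^ p / (2 * C ^ p)) ≤ ENNReal.ofReal (C₁ * φ r ^ p) := by
    refine le_trans ?_ (hint r hr)
    calc ENNReal.ofReal (φ s ^ p / (2 * C ^ p))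
        = ∫⁻ _ in Set.Ioo s (2 * s), ENNReal.ofReal ((φ s / C) ^ p / (2 * s)) := by
          rw [setLIntegral_const, Real.volume_Ioo, ← ENNReal.ofReal_mul (by positivity),
            Real.div_rpow hφs.le hC0.le]
          congr 1
          field_simp
          ring
      _ ≤ ∫⁻ t in Set.Ioo s (2 * s), ENNReal.ofReal (φ t ^ p / t) := by
          refine setLIntegral_mono' measurableSet_Ioo fun t ht => ENNReal.ofReal_le_ofReal ?_
          have ht0 : 0 < t := hs.trans ht.1
          have hφt : 0 < φ t := hφ ht0
          have h1 : φ s / C ≤ φ t := by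
            rw [div_le_iff₀ hC0, mul_comm]
            exact h.le_mul hφ hs ht0 ht.2.le (by linarith [ht.1])
          have := ht.2.le
          gcongr
      _ ≤ ∫⁻ t in Set.Ioi r, ENNReal.ofReal (φ t ^ p / t) :=
          lintegral_mono_set fun t ht => hrs.trans_lt ht.1
  have h2 : φ s ^ p ≤ max 1 (2 * C ^ p * |C₁|) * φ r ^ p := by
    have h3 : φ s ^ p / (2 * C ^ p) ≤ |C₁| * φ r ^ p := by
      refine (ENNReal.ofReal_le_ofReal_iff (by positivity)).1 (key.trans ?_)
      exact ENNReal.ofReal_le_ofReal (by gcongr; exact le_abs_self _)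
    rw [div_le_iff₀ (by positivity)] at h3
    calc φ s ^ p ≤ 2 * C ^ p * |C₁| * φ r ^ p := by linarith
      _ ≤ _ := by gcongr; exact le_max_right _ _
  have hm : 0 ≤ max 1 (2 * C ^ p * |C₁|) := zero_le_one.trans (le_max_left _ _)
  calc φ s = (φ s ^ p) ^ (1 / p) := by
        rw [← Real.rpow_mul hφs.le, mul_one_div_cancel hp.ne', Real.rpow_one]
    _ ≤ (max 1 (2 * C ^ p * |C₁|) * φ r ^ p) ^ (1 / p) := by gcongr
    _ = _ := by
        rw [Real.mul_rpow hm (by positivity), ← Real.rpow_mul hφr.le,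
          mul_one_div_cancel hp.ne', Real.rpow_one]

namespace IsRegularQuasiMetric

variable {X : Type*} [MeasurableSpace X] {μ : Measure X} {d : X → X → ℝ} {Q K : ℝ} {c : ℝ≥0∞}

lemma lintegral_ball_le_of_morreyBound (h : IsRegularQuasiMetric μ d Q K c) {p : ℝ} (hp : 1 < p)
    {φ : ℝ → ℝ} (hφ : Set.MapsTo φ (Set.Ioi 0) (Set.Ioi 0)) {g : X → ℝ≥0∞} (hg : Measurable g)
    {b : ℝ≥0∞} (hb : MorreyBound μ d Q p φ g b) (x : X) {r : ℝ} (hr : 0 < r) :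
    ∫⁻ y in distBall d x r, g y ∂μ ≤ c ^ (1 - 1 / p) * ENNReal.ofReal (r ^ Q * φ r) * b := by
  have hp0 : 0 < p := by linarith
  have hφr : 0 < φ r := hφ hr
  have hrQ : 0 < r ^ Q := Real.rpow_pos_of_pos hr Q
  have hp1 : 1 / p ≤ 1 := by rw [div_le_one hp0]; exact hp.le
  have hconj : p.HolderConjugate (Real.conjExponent p) := Real.HolderConjugate.conjExponent hp
  have hq : 1 / Real.conjExponent p = 1 - 1 / p := by
    have := hconj.inv_add_inv_eq_one
    rw [one_div, one_div]
    linarith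
  have hol := ENNReal.lintegral_mul_le_Lp_mul_Lq (μ.restrict (distBall d x r)) hconj
    hg.aemeasurable (aemeasurable_const (b := (1 : ℝ≥0∞)))
  simp only [Pi.mul_apply, mul_one, ENNReal.one_rpow, lintegral_one, Measure.restrict_apply_univ,
    hq, h.measure_ball x r hr] at hol
  calc ∫⁻ y in distBall d x r, g y ∂μ
      ≤ (∫⁻ y in distBall d x r, g y ^ p ∂μ) ^ (1 / p) *
          (c * ENNReal.ofReal (r ^ Q)) ^ (1 - 1 / p) := hol
    _ ≤ (ENNReal.ofReal (r ^ Q * φ r ^ p) * b ^ p) ^ (1 / p) *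
          (c * ENNReal.ofReal (r ^ Q)) ^ (1 - 1 / p) := by
        gcongr
        exact hb x r hr
    _ = c ^ (1 - 1 / p) * (ENNReal.ofReal (r ^ Q * φ r ^ p) ^ (1 / p) *
          ENNReal.ofReal (r ^ Q) ^ (1 - 1 / p)) * b := by
        rw [ENNReal.mul_rpow_of_nonneg _ _ (by positivity : 0 ≤ 1 / p),
          ENNReal.mul_rpow_of_nonneg _ _ (by linarith : 0 ≤ 1 - 1 / p), ← ENNReal.rpow_mul,
          mul_one_div_cancel hp0.ne', ENNReal.rpow_one]
        ring
    _ = _ := by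
        have e : (r ^ Q) ^ (1 / p) * φ r * (r ^ Q) ^ (1 - 1 / p) = r ^ Q * φ r := by
          rw [mul_right_comm, ← Real.rpow_add hrQ, add_sub_cancel, Real.rpow_one]
        rw [ENNReal.ofReal_rpow_of_pos (by positivity), ENNReal.ofReal_rpow_of_pos hrQ,
          ← ENNReal.ofReal_mul (by positivity), Real.mul_rpow hrQ.le (by positivity),
          ← Real.rpow_mul hφr.le, mul_one_div_cancel hp0.ne', Real.rpow_one, e]

/-- The maximal function is bounded on the generalised Morrey space. -/
lemma exists_lintegral_ball_maximalFunction_le [SFinite μ] (h : IsRegularQuasiMetric μ d Q K c)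
    {p : ℝ} (hp : 1 < p) {φ : ℝ → ℝ} (hφ : Set.MapsTo φ (Set.Ioi 0) (Set.Ioi 0)) {D : ℝ}
    (hD1 : 1 ≤ D) (hD : ∀ r s, 0 < r → r ≤ s → φ s ≤ D * φ r) :
    ∃ C : ℝ≥0∞, C ≠ ⊤ ∧ ∀ (g : X → ℝ≥0∞) (b : ℝ≥0∞), Measurable g →
      MorreyBound μ d Q p φ g b → ∀ x r, 0 < r →
        ∫⁻ y in distBall d x r, maximalFunction μ d Q g y ^ p ∂μ ≤
          C * (ENNReal.ofReal (r ^ Q * φ r ^ p) * b ^ p) := by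
  have hp0 : 0 < p := by linarith
  have hp1 : 0 ≤ 1 - 1 / p := by rw [sub_nonneg, div_le_one hp0]; exact hp.le
  have hK : 0 < K := zero_lt_one.trans_le h.one_le
  have hD0 : 0 < D := by linarith
  set A := ENNReal.ofReal p * (2 * (c * ENNReal.ofReal ((2 * K) ^ Q))) *
        (ENNReal.ofReal (1 / (p - 1)) * (2 * c) ^ (p - 1)) with hA
  have hc := h.ne_top
  have hAtop : A ≠ ⊤ := by
    have : (2 * c) ^ (p - 1) ≠ ⊤ := ENNReal.rpow_ne_top_of_nonneg (by linarith)
      (ENNReal.mul_ne_top ENNReal.ofNat_ne_top hc)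
    finiteness
  have hcp : (c ^ (1 - 1 / p)) ^ p ≠ ⊤ := ENNReal.rpow_ne_top_of_nonneg hp0.le
    (ENNReal.rpow_ne_top_of_nonneg hp1 hc)
  refine ⟨2 ^ (p - 1) * (A * ENNReal.ofReal (K ^ Q * D ^ p) +
    (c ^ (1 - 1 / p)) ^ p * c * ENNReal.ofReal (D ^ p)), ?_, ?_⟩
  · have : (2 : ℝ≥0∞) ^ (p - 1) ≠ ⊤ :=
      ENNReal.rpow_ne_top_of_nonneg (by linarith) ENNReal.ofNat_ne_top
    finiteness
  intro g b hg hb x₀ r hr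
  have hφr : 0 < φ r := hφ hr
  have hrQ : 0 < r ^ Q := Real.rpow_pos_of_pos hr Q
  set g₁ : X → ℝ≥0∞ := (distBall d x₀ (K * r)).indicator g with hg₁
  have hg₁m : Measurable g₁ := hg.indicator (h.measurableSet_ball _ _)
  set a : ℝ≥0∞ := c ^ (1 - 1 / p) * ENNReal.ofReal (D * φ r) * b with ha
  have hM : ∀ x ∈ distBall d x₀ r, maximalFunction μ d Q g x ≤ maximalFunction μ d Q g₁ x + a := by
    intro x (hx : d x₀ x < r)
    refine iSup₂_le fun s hs => ?_
    have hs0 : (0 : ℝ) < s := by exact_mod_cast hs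
    have hsQ : (0 : ℝ) < (s : ℝ) ^ Q := Real.rpow_pos_of_pos hs0 Q
    rcases le_or_gt (s : ℝ) r with hsr | hsr
    · refine le_add_right (le_iSup₂_of_le s hs ?_)
      gcongr 1
      refine setLIntegral_mono' (h.measurableSet_ball _ _) fun y (hy : d x y < s) => ?_
      have : y ∈ distBall d x₀ (K * r) :=
        (h.quasi_triangle x₀ x y).trans_lt
          (mul_lt_mul_of_pos_left (max_lt hx (hy.trans_le hsr)) hK)
      rw [hg₁, Set.indicator_of_mem this]
    · refine le_add_left ?_
      calc ENNReal.ofReal (1 / (s : ℝ) ^ Q) * ∫⁻ y in distBall d x s, g y ∂μ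
          ≤ ENNReal.ofReal (1 / (s : ℝ) ^ Q) *
              (c ^ (1 - 1 / p) * ENNReal.ofReal ((s : ℝ) ^ Q * φ s) * b) := by
            gcongr
            exact h.lintegral_ball_le_of_morreyBound hp hφ hg hb x hs0
        _ = c ^ (1 - 1 / p) * ENNReal.ofReal (φ s) * b *
              (ENNReal.ofReal ((s : ℝ) ^ Q) * ENNReal.ofReal (1 / (s : ℝ) ^ Q)) := by
            rw [ENNReal.ofReal_mul hsQ.le]
            ring
        _ ≤ a := by
            rw [ofReal_mul_ofReal_one_div hsQ, mul_one, ha]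
            gcongr
            exact hD r s hr hsr.le
  calc ∫⁻ y in distBall d x₀ r, maximalFunction μ d Q g y ^ p ∂μ
      ≤ ∫⁻ y in distBall d x₀ r, 2 ^ (p - 1) * (maximalFunction μ d Q g₁ y ^ p + a ^ p) ∂μ := by
        refine setLIntegral_mono' (h.measurableSet_ball _ _) fun y hy => ?_
        refine (ENNReal.rpow_le_rpow (hM y hy) hp0.le).trans ?_
        exact ENNReal.rpow_add_le_mul_rpow_add_rpow _ _ hp.le
    _ = 2 ^ (p - 1) * (∫⁻ y in distBall d x₀ r, maximalFunction μ d Q g₁ y ^ p ∂μ +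
          a ^ p * (c * ENNReal.ofReal (r ^ Q))) := by
        have hm := (h.measurable_maximalFunction hg₁m).pow_const p
        rw [lintegral_const_mul _ (hm.add_const _), lintegral_add_left hm, setLIntegral_const,
          h.measure_ball _ _ hr]
    _ ≤ 2 ^ (p - 1) * (A * (ENNReal.ofReal (K ^ Q * D ^ p) *
          (ENNReal.ofReal (r ^ Q * φ r ^ p) * b ^ p)) +
          a ^ p * (c * ENNReal.ofReal (r ^ Q))) := by
        gcongr 2 ^ (p - 1) * (?_ + _)
        calc ∫⁻ y in distBall d x₀ r, maximalFunction μ d Q g₁ y ^ p ∂μ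
            ≤ ∫⁻ y, maximalFunction μ d Q g₁ y ^ p ∂μ :=
              lintegral_mono' Measure.restrict_le_self le_rfl
          _ ≤ A * ∫⁻ y, g₁ y ^ p ∂μ := h.lintegral_maximalFunction_rpow_le hp hg₁m
          _ = A * ∫⁻ y in distBall d x₀ (K * r), g y ^ p ∂μ := by
              rw [← lintegral_indicator (h.measurableSet_ball _ _)]
              congr 2 with y
              by_cases hy : y ∈ distBall d x₀ (K * r) <;> simp [hg₁, hy, hp0]
          _ ≤ A * (ENNReal.ofReal ((K * r) ^ Q * φ (K * r) ^ p) * b ^ p) := by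
              gcongr
              exact hb x₀ _ (by positivity)
          _ ≤ A * (ENNReal.ofReal ((K * r) ^ Q * (D * φ r) ^ p) * b ^ p) := by
              have h1 : 0 < φ (K * r) := hφ (show 0 < K * r by positivity)
              have h2 := hD r (K * r) hr (by nlinarith [h.one_le])
              gcongr
          _ = _ := by
              rw [← mul_assoc (ENNReal.ofReal (K ^ Q * D ^ p)), ← ENNReal.ofReal_mul (by positivity),
                Real.mul_rpow hK.le hr.le, Real.mul_rpow hD0.le hφr.le]
              congr 3
              ring_nf
    _ = _ := by
        rw [ha, ENNReal.mul_rpow_of_nonneg _ _ hp0.le, ENNReal.mul_rpow_of_nonneg _ _ hp0.le,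
          ENNReal.ofReal_rpow_of_pos (by positivity), Real.mul_rpow hD0.le hφr.le,
          ENNReal.ofReal_mul (p := D ^ p) (by positivity), ENNReal.ofReal_mul hrQ.le]
        ring

end IsRegularQuasiMetric

/-- The generalised fractional integral of a nonnegative function. -/
noncomputable def fracLIntegral {X : Type*} [MeasurableSpace X] (μ : Measure X) (d : X → X → ℝ)
    (Q : ℝ) (ρ : ℝ → ℝ) (g : X → ℝ≥0∞) (x : X) : ℝ≥0∞ :=
  ∫⁻ y, ENNReal.ofReal (ρ (d x y) / d x y ^ Q) * g y ∂μ

lemma Doubling.ofReal_div_rpow_le {Cρ Q α δ : ℝ} {ρ : ℝ → ℝ} (h : Doubling Cρ ρ)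
    (hρ : Set.MapsTo ρ (Set.Ioi 0) (Set.Ioi 0)) (hQ : 0 < Q) (hα : α ≤ 1) (hα' : 1 ≤ 2 * α)
    (hδ : 0 < δ) : ENNReal.ofReal (ρ δ / δ ^ Q) ≤ ENNReal.ofReal (Cρ * (2 * 2 ^ Q)) *
      ∫⁻ t in Set.Ioo (α * δ) (2 * α * δ), ENNReal.ofReal (ρ t / t / t ^ Q) := by
  have hC : 1 ≤ Cρ := h.one_le hρ
  have hα0 : 0 < α := by linarith
  have hρδ : 0 < ρ δ := hρ hδ
  rw [← lintegral_const_mul' _ _ ENNReal.ofReal_ne_top]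
  calc ENNReal.ofReal (ρ δ / δ ^ Q)
      = ∫⁻ _ in Set.Ioo (α * δ) (2 * α * δ), ENNReal.ofReal (ρ δ / δ ^ Q / (α * δ)) := by
        rw [setLIntegral_const, Real.volume_Ioo, ← ENNReal.ofReal_mul (by positivity)]
        congr 1
        field_simp
        ring
    _ ≤ _ := by
        refine setLIntegral_mono' measurableSet_Ioo fun t ht => ?_
        have ht0 : 0 < t := (mul_pos hα0 hδ).trans ht.1
        have hρt : 0 < ρ t := hρ ht0
        have ht2 : t ≤ 2 * δ := ht.2.le.trans (by nlinarith)
        rw [← ENNReal.ofReal_mul (by positivity)]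
        refine ENNReal.ofReal_le_ofReal ?_
        have h1 : ρ δ ≤ Cρ * ρ t := h.le_mul hρ hδ ht0 ht2 (by nlinarith [ht.1])
        have h2 : (δ ^ Q)⁻¹ ≤ 2 ^ Q * (t ^ Q)⁻¹ := by
          rw [← div_eq_mul_inv, le_div_iff₀ (by positivity), mul_comm, ← div_eq_mul_inv,
            div_le_iff₀ (by positivity), ← Real.mul_rpow two_pos.le hδ.le]
          gcongr
        have h3 : (α * δ)⁻¹ ≤ 2 * t⁻¹ := by
          rw [← div_eq_mul_inv, le_div_iff₀ (by positivity), mul_comm, ← div_eq_mul_inv,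
            div_le_iff₀ (by positivity)]
          linarith [ht.2]
        calc ρ δ / δ ^ Q / (α * δ) = ρ δ * (δ ^ Q)⁻¹ * (α * δ)⁻¹ := by
              rw [div_eq_mul_inv, div_eq_mul_inv]
          _ ≤ (Cρ * ρ t) * (2 ^ Q * (t ^ Q)⁻¹) * (2 * t⁻¹) := by gcongr
          _ = Cρ * (2 * 2 ^ Q) * (ρ t / t / t ^ Q) := by
              rw [div_eq_mul_inv, div_eq_mul_inv]
              ring

namespace IsRegularQuasiMetric

variable {X : Type*} [MeasurableSpace X] {μ : Measure X} {d : X → X → ℝ} {Q K : ℝ} {c : ℝ≥0∞}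

/-- A piece of the fractional integral is controlled by an average over scales of ball integrals. -/
lemma setLIntegral_kernel_le [SFinite μ] (h : IsRegularQuasiMetric μ d Q K c) {Cρ α : ℝ}
    {ρ : ℝ → ℝ} (hρm : Measurable ρ) (hd : Doubling Cρ ρ)
    (hρ : Set.MapsTo ρ (Set.Ioi 0) (Set.Ioi 0)) (hα : α ≤ 1) (hα' : 1 ≤ 2 * α)
    {g : X → ℝ≥0∞} (hg : Measurable g) {x : X} {P : Set X} {T : Set ℝ} (hP : MeasurableSet P)
    (hPT : ∀ y ∈ P, Set.Ioo (α * d x y) (2 * α * d x y) ⊆ T) :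
    ∫⁻ y in P, ENNReal.ofReal (ρ (d x y) / d x y ^ Q) * g y ∂μ ≤
      ENNReal.ofReal (Cρ * (2 * 2 ^ Q)) * ∫⁻ t in T, ENNReal.ofReal (ρ t / t / t ^ Q) *
        ∫⁻ y in distBall d x (t / α), g y ∂μ := by
  have hα0 : 0 < α := by linarith
  have hdm : Measurable fun y => d x y := h.measurable.comp measurable_prodMk_left
  have hS : MeasurableSet {z : X × ℝ | d x z.1 < z.2 / α} :=
    measurableSet_lt (hdm.comp measurable_fst) (by fun_prop)
  have hF : Measurable (Function.uncurry fun (y : X) (t : ℝ) =>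
      {z : X × ℝ | d x z.1 < z.2 / α}.indicator
        (fun z => ENNReal.ofReal (ρ z.2 / z.2 / z.2 ^ Q) * g z.1) (y, t)) := by
    refine Measurable.indicator ?_ hS
    exact Measurable.mul (by fun_prop) (hg.comp measurable_fst)
  calc ∫⁻ y in P, ENNReal.ofReal (ρ (d x y) / d x y ^ Q) * g y ∂μ
      ≤ ∫⁻ y in P, ENNReal.ofReal (Cρ * (2 * 2 ^ Q)) * (∫⁻ t in T,
          {z : X × ℝ | d x z.1 < z.2 / α}.indicator
            (fun z => ENNReal.ofReal (ρ z.2 / z.2 / z.2 ^ Q) * g z.1) (y, t)) ∂μ := by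
        refine setLIntegral_mono' hP fun y hy => ?_
        rcases (h.nonneg x y).eq_or_lt with h0 | h0
        · simp [← h0, Real.zero_rpow h.dim_pos.ne']
        · calc ENNReal.ofReal (ρ (d x y) / d x y ^ Q) * g y
              ≤ ENNReal.ofReal (Cρ * (2 * 2 ^ Q)) *
                  (∫⁻ t in Set.Ioo (α * d x y) (2 * α * d x y),
                    ENNReal.ofReal (ρ t / t / t ^ Q)) * g y := by
                gcongr
                exact hd.ofReal_div_rpow_le hρ h.dim_pos hα hα' h0
            _ = ENNReal.ofReal (Cρ * (2 * 2 ^ Q)) *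
                  ∫⁻ t in Set.Ioo (α * d x y) (2 * α * d x y),
                    ENNReal.ofReal (ρ t / t / t ^ Q) * g y := by
                rw [lintegral_mul_const _ (by fun_prop), mul_assoc]
            _ = ENNReal.ofReal (Cρ * (2 * 2 ^ Q)) *
                  ∫⁻ t in Set.Ioo (α * d x y) (2 * α * d x y),
                    {z : X × ℝ | d x z.1 < z.2 / α}.indicator
                      (fun z => ENNReal.ofReal (ρ z.2 / z.2 / z.2 ^ Q) * g z.1) (y, t) := by
                congr 1
                refine setLIntegral_congr_fun measurableSet_Ioo fun t ht => ?_
                have : (y, t) ∈ {z : X × ℝ | d x z.1 < z.2 / α} := by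
                  change d x y < t / α
                  rw [lt_div_iff₀ hα0, mul_comm]
                  exact ht.1
                rw [Set.indicator_of_mem this]
            _ ≤ _ := by
                gcongr 1
                exact lintegral_mono_set (hPT y hy)
    _ ≤ ENNReal.ofReal (Cρ * (2 * 2 ^ Q)) * ∫⁻ y, (∫⁻ t in T,
          {z : X × ℝ | d x z.1 < z.2 / α}.indicator
            (fun z => ENNReal.ofReal (ρ z.2 / z.2 / z.2 ^ Q) * g z.1) (y, t)) ∂μ := by
        rw [← lintegral_const_mul' _ _ ENNReal.ofReal_ne_top]
        exact lintegral_mono' Measure.restrict_le_self le_rfl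
    _ = ENNReal.ofReal (Cρ * (2 * 2 ^ Q)) * ∫⁻ t in T, ∫⁻ y,
          {z : X × ℝ | d x z.1 < z.2 / α}.indicator
            (fun z => ENNReal.ofReal (ρ z.2 / z.2 / z.2 ^ Q) * g z.1) (y, t) ∂μ := by
        rw [lintegral_lintegral_swap hF.aemeasurable]
    _ = _ := by
        congr 2 with t
        rw [← lintegral_const_mul _ hg, ← lintegral_indicator (h.measurableSet_ball _ _)]
        rfl

lemma _root_.fracLIntegral_eq_zero {ρ : ℝ → ℝ}
    {g : X → ℝ≥0∞} (hg : Measurable g) {x : X}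
    (h0 : ∀ r : ℝ, 0 < r → ∫⁻ y in distBall d x r, g y ∂μ = 0) :
    fracLIntegral μ d Q ρ g x = 0 := by
  have hU : ⋃ n : ℕ, distBall d x (n + 1) = Set.univ := by
    refine Set.eq_univ_of_forall fun y => Set.mem_iUnion.2 ?_
    obtain ⟨n, hn⟩ := exists_nat_gt (d x y)
    exact ⟨n, show d x y < n + 1 by linarith⟩
  have hg0 : ∫⁻ y, g y ∂μ = 0 := by
    rw [← setLIntegral_univ, ← hU]
    refine le_antisymm ((lintegral_iUnion_le _ _).trans ?_) bot_le
    simp [h0 _ (Nat.cast_add_one_pos (α := ℝ) _)]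
  rw [lintegral_eq_zero_iff hg] at hg0
  rw [fracLIntegral, lintegral_eq_zero_of_ae_eq_zero]
  filter_upwards [hg0] with y hy
  simp [hy]

/-- Hedberg's pointwise estimate. -/
lemma exists_fracLIntegral_le [SFinite μ] (h : IsRegularQuasiMetric μ d Q K c) {p θ : ℝ}
    (hp : 1 < p) (hθ : 0 < θ) (hθ1 : θ < 1) {φ : ℝ → ℝ}
    (hφ : Set.MapsTo φ (Set.Ioi 0) (Set.Ioi 0)) (hφs : Set.SurjOn φ (Set.Ioi 0) (Set.Ioi 0))
    (Cρ C₂ : ℝ) :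
    ∃ C : ℝ≥0∞, C ≠ ⊤ ∧ ∀ ρ : ℝ → ℝ, Measurable ρ → Set.MapsTo ρ (Set.Ioi 0) (Set.Ioi 0) →
      Doubling Cρ ρ →
      (∀ r : ℝ, 0 < r →
        ENNReal.ofReal (φ r) * (∫⁻ t in Set.Ioo 0 r, ENNReal.ofReal (ρ t / t)) +
          (∫⁻ t in Set.Ioi r, ENNReal.ofReal (ρ t * φ t / t)) ≤
            ENNReal.ofReal (C₂ * φ r ^ θ)) →
      ∀ (g : X → ℝ≥0∞) (b : ℝ≥0∞), Measurable g → MorreyBound μ d Q p φ g b → b ≠ ⊤ →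
      ∀ x, fracLIntegral μ d Q ρ g x ≤ C * (maximalFunction μ d Q g x ^ θ * b ^ (1 - θ)) := by
  have hp1 : 0 ≤ 1 - 1 / p := by
    rw [sub_nonneg, div_le_one (by linarith)]; exact hp.le
  have hc := h.ne_top
  have hcp : c ^ (1 - 1 / p) ≠ ⊤ := ENNReal.rpow_ne_top_of_nonneg hp1 hc
  set L := ENNReal.ofReal (Cρ * (2 * 2 ^ Q)) * (ENNReal.ofReal (4 ^ Q) + c ^ (1 - 1 / p)) with hL
  refine ⟨1 + L * ENNReal.ofReal C₂, by finiteness, ?_⟩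
  intro ρ hρm hρ hd hint g b hg hb hbtop x
  set a := maximalFunction μ d Q g x with ha
  rcases eq_or_ne b 0 with hb0 | hb0
  · rw [fracLIntegral_eq_zero hg]
    · exact bot_le
    · intro r hr
      have := h.lintegral_ball_le_of_morreyBound hp hφ hg hb x hr
      rw [hb0, mul_zero] at this
      exact le_antisymm this bot_le
  rcases eq_or_ne a 0 with ha0 | ha0
  · rw [fracLIntegral_eq_zero hg]
    · exact bot_le
    · intro r hr
      have := h.lintegral_ball_le g x hr
      rw [← ha, ha0, mul_zero] at this
      exact le_antisymm this bot_le
  rcases eq_or_ne a ⊤ with hat | hat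
  · have h1 : b ^ (1 - θ) ≠ 0 := by
      rw [Ne, ENNReal.rpow_eq_zero_iff]
      rintro (⟨h1, -⟩ | ⟨h1, -⟩)
      exacts [hb0 h1, hbtop h1]
    rw [hat, ENNReal.top_rpow_of_pos hθ, ENNReal.top_mul h1, ENNReal.mul_top (by simp)]
    exact le_top
  have hab0 : a / b ≠ 0 := ENNReal.div_ne_zero.2 ⟨ha0, hbtop⟩
  have habt : a / b ≠ ⊤ := ENNReal.div_ne_top hat hb0
  obtain ⟨r, hr, hφr⟩ := hφs (show (a / b).toReal ∈ Set.Ioi 0 from ENNReal.toReal_pos hab0 habt)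
  have hr : 0 < r := hr
  have hφr' : ENNReal.ofReal (φ r) = a / b := by rw [hφr, ENNReal.ofReal_toReal habt]
  have hφr0 : 0 < φ r := hφ hr
  have hba : b * ENNReal.ofReal (φ r) = a := by
    rw [hφr', ENNReal.mul_div_cancel hb0 hbtop]
  have hball := h.measurableSet_ball x r
  have near : ∫⁻ y in distBall d x r, ENNReal.ofReal (ρ (d x y) / d x y ^ Q) * g y ∂μ ≤
      ENNReal.ofReal (Cρ * (2 * 2 ^ Q)) * (ENNReal.ofReal (4 ^ Q) * (a *
        ∫⁻ t in Set.Ioo 0 r, ENNReal.ofReal (ρ t / t))) := by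
    refine (h.setLIntegral_kernel_le hρm hd hρ (α := 1 / 2) (T := Set.Ioo 0 r) (by norm_num)
      (by norm_num) hg hball ?_).trans ?_
    · intro y (hy : d x y < r) t ht
      have := h.nonneg x y
      exact ⟨by linarith [ht.1], by linarith [ht.2]⟩
    gcongr 1
    rw [← mul_assoc, ← lintegral_const_mul _ (by fun_prop)]
    refine setLIntegral_mono' measurableSet_Ioo fun t ht => ?_
    have ht0 : 0 < t := ht.1
    have hρt : 0 < ρ t := hρ ht0
    calc ENNReal.ofReal (ρ t / t / t ^ Q) * ∫⁻ y in distBall d x (t / (1 / 2)), g y ∂μ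
        ≤ ENNReal.ofReal (ρ t / t / t ^ Q) * (ENNReal.ofReal ((2 * (t / (1 / 2))) ^ Q) * a) := by
          gcongr
          exact h.lintegral_ball_le g x (by positivity)
      _ = ENNReal.ofReal (4 ^ Q) * a * ENNReal.ofReal (ρ t / t) := by
          rw [← mul_assoc, ← ENNReal.ofReal_mul (by positivity), mul_right_comm,
            ← ENNReal.ofReal_mul (by positivity), show 2 * (t / (1 / 2)) = 4 * t by ring,
            Real.mul_rpow (by norm_num) ht0.le]
          congr 2
          field_simp
  have far : ∫⁻ y in (distBall d x r)ᶜ, ENNReal.ofReal (ρ (d x y) / d x y ^ Q) * g y ∂μ ≤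
      ENNReal.ofReal (Cρ * (2 * 2 ^ Q)) * (c ^ (1 - 1 / p) * (b *
        ∫⁻ t in Set.Ioi r, ENNReal.ofReal (ρ t * φ t / t))) := by
    refine (h.setLIntegral_kernel_le hρm hd hρ (α := 1) (T := Set.Ioi r) (by norm_num)
      (by norm_num) hg hball.compl ?_).trans ?_
    · intro y hy t ht
      have hy' : r ≤ d x y := not_lt.1 hy
      exact lt_of_le_of_lt hy' (by linarith [ht.1])
    gcongr 1
    rw [← mul_assoc, ← lintegral_const_mul' _ _ (by finiteness)]
    refine setLIntegral_mono' measurableSet_Ioi fun t ht => ?_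
    have ht0 : 0 < t := hr.trans ht
    have hρt : 0 < ρ t := hρ ht0
    have hφt : 0 < φ t := hφ ht0
    rw [div_one]
    calc ENNReal.ofReal (ρ t / t / t ^ Q) * ∫⁻ y in distBall d x t, g y ∂μ
        ≤ ENNReal.ofReal (ρ t / t / t ^ Q) *
            (c ^ (1 - 1 / p) * ENNReal.ofReal (t ^ Q * φ t) * b) := by
          gcongr
          exact h.lintegral_ball_le_of_morreyBound hp hφ hg hb x ht0
      _ = c ^ (1 - 1 / p) * b *
            (ENNReal.ofReal (ρ t / t / t ^ Q) * ENNReal.ofReal (t ^ Q * φ t)) := by ring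
      _ = _ := by
          rw [← ENNReal.ofReal_mul (by positivity)]
          congr 2
          field_simp
  have hI := hint r hr
  set I₀ := ∫⁻ t in Set.Ioo 0 r, ENNReal.ofReal (ρ t / t)
  set I₁ := ∫⁻ t in Set.Ioi r, ENNReal.ofReal (ρ t * φ t / t)
  calc fracLIntegral μ d Q ρ g x
      = ∫⁻ y in distBall d x r, ENNReal.ofReal (ρ (d x y) / d x y ^ Q) * g y ∂μ +
          ∫⁻ y in (distBall d x r)ᶜ, ENNReal.ofReal (ρ (d x y) / d x y ^ Q) * g y ∂μ :=
        (lintegral_add_compl _ hball).symm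
    _ ≤ ENNReal.ofReal (Cρ * (2 * 2 ^ Q)) * (ENNReal.ofReal (4 ^ Q) * (a * I₀)) +
          ENNReal.ofReal (Cρ * (2 * 2 ^ Q)) * (c ^ (1 - 1 / p) * (b * I₁)) := add_le_add near far
    _ ≤ ENNReal.ofReal (Cρ * (2 * 2 ^ Q)) *
            ((ENNReal.ofReal (4 ^ Q) + c ^ (1 - 1 / p)) * (a * I₀)) +
          ENNReal.ofReal (Cρ * (2 * 2 ^ Q)) *
            ((ENNReal.ofReal (4 ^ Q) + c ^ (1 - 1 / p)) * (b * I₁)) := by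
        gcongr
        · exact le_self_add
        · exact le_add_self
    _ = L * (b * (ENNReal.ofReal (φ r) * I₀ + I₁)) := by
        rw [hL, ← hba]
        ring
    _ ≤ L * (b * ENNReal.ofReal (C₂ * φ r ^ θ)) := by gcongr
    _ = L * ENNReal.ofReal C₂ * (b * (a / b) ^ θ) := by
        rw [ENNReal.ofReal_mul' (by positivity), ← hφr', ENNReal.ofReal_rpow_of_pos hφr0]
        ring
    _ = L * ENNReal.ofReal C₂ * (a ^ θ * b ^ (1 - θ)) := by
        rw [ENNReal.rpow_sub _ _ hb0 hbtop, ENNReal.rpow_one,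
          ENNReal.div_rpow_of_nonneg _ _ hθ.le, ENNReal.div_eq_inv_mul, ENNReal.div_eq_inv_mul]
        ring
    _ ≤ _ := by
        gcongr
        exact le_add_self

/-- The generalised fractional integral is bounded between generalised Morrey spaces. -/
theorem exists_fracLIntegral_morreyBound [SFinite μ] (h : IsRegularQuasiMetric μ d Q K c)
    {p q : ℝ} (hp : 1 < p) (hpq : p < q) {φ : ℝ → ℝ}
    (hφ : Set.MapsTo φ (Set.Ioi 0) (Set.Ioi 0)) (hφs : Set.SurjOn φ (Set.Ioi 0) (Set.Ioi 0))
    {Cφ C₁ : ℝ} (hφd : Doubling Cφ φ) (hφint : ∀ r : ℝ, 0 < r →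
      ∫⁻ t in Set.Ioi r, ENNReal.ofReal (φ t ^ p / t) ≤ ENNReal.ofReal (C₁ * φ r ^ p))
    (Cρ C₂ : ℝ) :
    ∃ C : ℝ≥0∞, C ≠ ⊤ ∧ ∀ ρ : ℝ → ℝ, Measurable ρ → Set.MapsTo ρ (Set.Ioi 0) (Set.Ioi 0) →
      Doubling Cρ ρ →
      (∀ r : ℝ, 0 < r →
        ENNReal.ofReal (φ r) * (∫⁻ t in Set.Ioo 0 r, ENNReal.ofReal (ρ t / t)) +
          (∫⁻ t in Set.Ioi r, ENNReal.ofReal (ρ t * φ t / t)) ≤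
            ENNReal.ofReal (C₂ * φ r ^ (p / q))) →
      ∀ (g : X → ℝ≥0∞) (b : ℝ≥0∞), Measurable g → MorreyBound μ d Q p φ g b → b ≠ ⊤ →
      MorreyBound μ d Q q (fun r => φ r ^ (p / q)) (fracLIntegral μ d Q ρ g) (C * b) := by
  have hp0 : 0 < p := by linarith
  have hq0 : 0 < q := by linarith
  have hθ : 0 < p / q := by positivity
  have hθ1 : p / q < 1 := (div_lt_one hq0).2 hpq
  obtain ⟨D, hD1, hD⟩ := hφd.exists_almost_decreasing hφ hp0 hφint
  obtain ⟨CM, hCM, hM⟩ := h.exists_lintegral_ball_maximalFunction_le hp hφ hD1 hD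
  obtain ⟨CH, hCH, hH⟩ := h.exists_fracLIntegral_le hp hθ hθ1 hφ hφs Cρ C₂
  refine ⟨CH * CM ^ (1 / q), ENNReal.mul_ne_top hCH
    (ENNReal.rpow_ne_top_of_nonneg (by positivity) hCM), ?_⟩
  intro ρ hρm hρ hd hint g b hg hb hbtop x r hr
  have hφr : 0 < φ r := hφ hr
  have hk : CH ^ q * b ^ (q - p) ≠ ⊤ := ENNReal.mul_ne_top
    (ENNReal.rpow_ne_top_of_nonneg hq0.le hCH)
    (ENNReal.rpow_ne_top_of_nonneg (by linarith) hbtop)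
  calc ∫⁻ y in distBall d x r, fracLIntegral μ d Q ρ g y ^ q ∂μ
      ≤ ∫⁻ y in distBall d x r, CH ^ q * b ^ (q - p) * maximalFunction μ d Q g y ^ p ∂μ := by
        refine lintegral_mono fun y => ?_
        refine (ENNReal.rpow_le_rpow (hH ρ hρm hρ hd hint g b hg hb hbtop y) hq0.le).trans ?_
        rw [ENNReal.mul_rpow_of_nonneg _ _ hq0.le, ENNReal.mul_rpow_of_nonneg _ _ hq0.le,
          ← ENNReal.rpow_mul, ← ENNReal.rpow_mul, div_mul_cancel₀ _ hq0.ne',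
          show (1 - p / q) * q = q - p by field_simp]
        exact le_of_eq (by ring)
    _ = CH ^ q * b ^ (q - p) * ∫⁻ y in distBall d x r, maximalFunction μ d Q g y ^ p ∂μ :=
        lintegral_const_mul' _ _ hk
    _ ≤ CH ^ q * b ^ (q - p) * (CM * (ENNReal.ofReal (r ^ Q * φ r ^ p) * b ^ p)) := by
        gcongr
        exact hM g b hg hb x r hr
    _ = ENNReal.ofReal (r ^ Q * φ r ^ p) * (CH ^ q * CM * (b ^ (q - p) * b ^ p)) := by ring
    _ = _ := by
        rw [← ENNReal.rpow_add_of_nonneg _ _ (by linarith) hp0.le, sub_add_cancel,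
          ENNReal.mul_rpow_of_nonneg _ _ hq0.le, ENNReal.mul_rpow_of_nonneg _ _ hq0.le,
          ← ENNReal.rpow_mul CM, one_div_mul_cancel hq0.ne', ENNReal.rpow_one]
        congr 3
        rw [← Real.rpow_mul hφr.le, div_mul_cancel₀ _ hq0.ne']

end IsRegularQuasiMetric

lemma dilation_one_apply {E : Type*} [NormedAddCommGroup E] [NormedSpace ℝ E] (A : E →L[ℝ] E)
    (x : E) : dilation A 1 x = x := by
  simp [dilation]

lemma trace_eq_sum_eigenvalues {E ι : Type*} [NormedAddCommGroup E] [NormedSpace ℝ E] [Fintype ι]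
    {A : E →L[ℝ] E} {b : Module.Basis ι ℝ E} {v : ι → ℝ} (h : ∀ i, A (b i) = v i • b i) :
    LinearMap.trace ℝ E (A : E →ₗ[ℝ] E) = ∑ i, v i := by
  classical
  rw [LinearMap.trace_eq_matrix_trace ℝ b, Matrix.trace]
  refine Finset.sum_congr rfl fun i _ => ?_
  simp [LinearMap.toMatrix_apply, h]

section Dilation

variable {E : Type*} [NormedAddCommGroup E] [NormedSpace ℝ E] [FiniteDimensional ℝ E]

lemma ContinuousLinearMap.exp_apply_eigenvector (A : E →L[ℝ] E) {x : E} {a : ℝ}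
    (h : A x = a • x) : NormedSpace.exp A x = Real.exp a • x := by
  have : CompleteSpace E := FiniteDimensional.complete ℝ E
  have hpow : ∀ n : ℕ, (A ^ n) x = a ^ n • x := by
    intro n
    induction n with
    | zero => simp
    | succ n ih =>
      rw [pow_succ, mul_apply_eq_comp, h, map_smul, ih, smul_smul, pow_succ, mul_comm]
  have h1 := (NormedSpace.exp_series_hasSum_exp' (𝕂 := ℝ) A).mapL
    (ContinuousLinearMap.apply ℝ E x)
  have h2 := (NormedSpace.exp_series_hasSum_exp' (𝕂 := ℝ) a).smul_const x
  rw [← Real.exp_eq_exp_ℝ] at h2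
  refine h1.unique (h2.congr_fun fun n => ?_)
  simp [hpow, smul_smul]

lemma dilation_apply_eigenvector (A : E →L[ℝ] E) {x : E} {a l : ℝ} (hl : 0 < l)
    (h : A x = a • x) : dilation A l x = l ^ a • x := by
  rw [dilation, ContinuousLinearMap.exp_apply_eigenvector (a := Real.log l * a),
    Real.rpow_def_of_pos hl]
  simp [h, smul_smul]

variable {ι : Type*} [Fintype ι] {A : E →L[ℝ] E} {b : Module.Basis ι ℝ E} {v : ι → ℝ}

lemma dilation_apply_eq_sum (h : ∀ i, A (b i) = v i • b i) {l : ℝ} (hl : 0 < l) (x : E) :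
    dilation A l x = ∑ i, (b.repr x i * l ^ v i) • b i := by
  conv_lhs => rw [← b.sum_repr x]
  rw [map_sum]
  refine Finset.sum_congr rfl fun i _ => ?_
  rw [map_smul, dilation_apply_eigenvector A hl (h i), smul_smul]

lemma dilation_dilation (h : ∀ i, A (b i) = v i • b i) {l m : ℝ} (hl : 0 < l) (hm : 0 < m)
    (x : E) : dilation A l (dilation A m x) = dilation A (l * m) x := by
  rw [dilation_apply_eq_sum h hm, dilation_apply_eq_sum h (mul_pos hl hm), map_sum]
  refine Finset.sum_congr rfl fun i _ => ?_
  rw [map_smul, dilation_apply_eigenvector A hl (h i), smul_smul, mul_assoc,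
    Real.mul_rpow hl.le hm.le, mul_comm (m ^ v i)]

lemma continuousOn_dilation (h : ∀ i, A (b i) = v i • b i) (x : E) :
    ContinuousOn (fun l => dilation A l x) (Set.Ioi 0) := by
  refine ContinuousOn.congr (f := fun l => ∑ i, (b.repr x i * l ^ v i) • b i) ?_
    fun l hl => dilation_apply_eq_sum h hl x
  refine continuousOn_finsetSum _ fun i _ => ContinuousOn.smul (ContinuousOn.mul
    continuousOn_const ?_) continuousOn_const
  exact fun l hl => (Real.continuousAt_rpow_const l _ (Or.inl (ne_of_gt hl))).continuousWithinAt

lemma tendsto_dilation_zero (h : ∀ i, A (b i) = v i • b i) (hv : ∀ i, 0 < v i) (x : E) :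
    Filter.Tendsto (fun l => dilation A l x) (nhdsWithin 0 (Set.Ioi 0)) (nhds 0) := by
  refine Filter.Tendsto.congr' (f₁ := fun l => ∑ i, (b.repr x i * l ^ v i) • b i) ?_ ?_
  · filter_upwards [self_mem_nhdsWithin] with l hl
    exact (dilation_apply_eq_sum h hl x).symm
  · have : (0 : E) = ∑ i, (b.repr x i * (0 : ℝ) ^ v i) • b i := by
      simp [Real.zero_rpow (hv _).ne']
    rw [this]
    refine tendsto_finsetSum _ fun i _ => Filter.Tendsto.smul_const (Filter.Tendsto.const_mul _ ?_) _
    exact ((Real.continuousAt_rpow_const 0 (v i) (Or.inr (hv i).le)).tendsto).mono_left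
      nhdsWithin_le_nhds

lemma det_dilation (h : ∀ i, A (b i) = v i • b i) {l : ℝ} (hl : 0 < l) :
    (dilation A l).det = l ^ LinearMap.trace ℝ E (A : E →ₗ[ℝ] E) := by
  classical
  have hm : LinearMap.toMatrix b b (dilation A l : E →ₗ[ℝ] E) =
      Matrix.diagonal fun i => l ^ v i := by
    ext i j
    simp only [LinearMap.toMatrix_apply, ContinuousLinearMap.coe_coe,
      dilation_apply_eigenvector A hl (h j), map_smul, Finsupp.smul_apply,
      Module.Basis.repr_self, Finsupp.single_apply, Matrix.diagonal_apply]
    by_cases hij : i = j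
    · simp [hij]
    · simp [hij, Ne.symm hij]
  rw [ContinuousLinearMap.det, ← LinearMap.det_toMatrix b, hm, Matrix.det_diagonal,
    trace_eq_sum_eigenvalues h, Real.rpow_sum_of_pos hl]

/-- A smooth family of maps that commutes with dilations and contains the identity has Jacobian
determinant one. -/
lemma det_fderiv_eq_one_of_dilation (h : ∀ i, A (b i) = v i • b i) (hv : ∀ i, 0 < v i)
    {F : E × E → E} (hF : ContDiff ℝ ∞ F) (hF0 : ∀ y, F (0, y) = y)
    (hFd : ∀ l : ℝ, 0 < l → ∀ x y, F (dilation A l x, dilation A l y) = dilation A l (F (x, y)))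
    (x y : E) : (fderiv ℝ (fun y => F (x, y)) y).det = 1 := by
  have hdiff : ∀ x, Differentiable ℝ fun y => F (x, y) := fun x =>
    (hF.differentiable (by simp)).comp (by fun_prop)
  have hfd : ∀ x y, fderiv ℝ (fun y => F (x, y)) y =
      (fderiv ℝ F (x, y)).comp (ContinuousLinearMap.inr ℝ E E) := by
    intro x y
    have h1 : HasFDerivAt F (fderiv ℝ F (x, y)) (x, y) :=
      ((hF.differentiable (by simp)) (x, y)).hasFDerivAt
    exact (h1.comp y (hasFDerivAt_prodMk_right x y)).fderiv
  have hcont : Continuous fun z : E × E => (fderiv ℝ (fun y => F (z.1, y)) z.2).det := by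
    simp only [hfd]
    exact ContinuousLinearMap.continuous_det.comp
      ((hF.continuous_fderiv (by simp)).clm_comp continuous_const)
  have hinv : ∀ l : ℝ, 0 < l →
      (fderiv ℝ (fun y => F (dilation A l x, y)) (dilation A l y)).det =
        (fderiv ℝ (fun y => F (x, y)) y).det := by
    intro l hl
    have h1 : HasFDerivAt (fun y => F (dilation A l x, dilation A l y))
        ((fderiv ℝ (fun y => F (dilation A l x, y)) (dilation A l y)).comp (dilation A l)) y :=
      ((hdiff (dilation A l x) (dilation A l y)).hasFDerivAt).comp y
        (dilation A l).hasFDerivAt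
    have h2 : HasFDerivAt (fun y => F (dilation A l x, dilation A l y))
        ((dilation A l).comp (fderiv ℝ (fun y => F (x, y)) y)) y := by
      simp only [hFd l hl]
      exact (dilation A l).hasFDerivAt.comp y (hdiff x y).hasFDerivAt
    have h3 := congrArg ContinuousLinearMap.det (h1.unique h2)
    have hne : (dilation A l).det ≠ 0 := by
      rw [det_dilation h hl]
      exact (Real.rpow_pos_of_pos hl _).ne'
    simp only [ContinuousLinearMap.det, ContinuousLinearMap.toLinearMap_comp,
      LinearMap.det_comp] at h3 hne ⊢
    rw [mul_comm] at h3
    exact mul_left_cancel₀ hne h3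
  have hlim : Filter.Tendsto
      (fun l => (fderiv ℝ (fun y => F (dilation A l x, y)) (dilation A l y)).det)
      (nhdsWithin 0 (Set.Ioi 0)) (nhds (fderiv ℝ (fun y => F ((0 : E), y)) 0).det) :=
    (hcont.tendsto (0, 0)).comp
      ((tendsto_dilation_zero h hv x).prodMk_nhds (tendsto_dilation_zero h hv y))
  have hconst : Filter.Tendsto
      (fun l => (fderiv ℝ (fun y => F (dilation A l x, y)) (dilation A l y)).det)
      (nhdsWithin 0 (Set.Ioi 0)) (nhds (fderiv ℝ (fun y => F (x, y)) y).det) := by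
    refine tendsto_const_nhds.congr' ?_
    filter_upwards [self_mem_nhdsWithin] with l hl
    exact (hinv l hl).symm
  rw [tendsto_nhds_unique hconst hlim]
  simp [hF0, ContinuousLinearMap.det]

end Dilation

lemma map_eq_self_of_det_fderiv_eq_one {E : Type*} [NormedAddCommGroup E] [NormedSpace ℝ E]
    [FiniteDimensional ℝ E] [MeasurableSpace E] [BorelSpace E] (ν : Measure E)
    [ν.IsAddHaarMeasure] {f : E → E} (hf : Differentiable ℝ f) (hbij : Function.Bijective f)
    (hdet : ∀ x, (fderiv ℝ f x).det = 1) : ν.map f = ν := by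
  ext s hs
  have hm : MeasurableSet (f ⁻¹' s) := hf.continuous.measurable hs
  have := lintegral_abs_det_fderiv_eq_addHaar_image ν hm
    (fun x _ => (hf x).hasFDerivAt.hasFDerivWithinAt) hbij.1.injOn
  rw [Set.image_preimage_eq s hbij.2] at this
  rw [Measure.map_apply hf.continuous.measurable hs, ← this]
  simp [hdet]

namespace HomogeneousGroup

section Algebra

variable {E G : Type*} [NormedAddCommGroup E] [NormedSpace ℝ E]
  [TopologicalSpace G] [ChartedSpace E G] [Group G]

lemma expMap_zero (H : HomogeneousGroup E G) : H.expMap 0 = 1 := by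
  have h := H.expMap_add 0 0 0
  simpa using h

lemma dil_expMap (H : HomogeneousGroup E G) (l : ℝ) (X : E) :
    H.dil l (H.expMap X) = H.expMap (dilation H.A l X) := by
  rw [dil, H.expMap.symm_apply_apply]

/-- The group law in exponential coordinates. -/
noncomputable def expMul (H : HomogeneousGroup E G) (z : E × E) : E :=
  H.expMap.symm (H.expMap z.1 * H.expMap z.2)

lemma expMap_expMul (H : HomogeneousGroup E G) (z : E × E) :
    H.expMap (H.expMul z) = H.expMap z.1 * H.expMap z.2 :=
  H.expMap.apply_symm_apply _

lemma expMul_zero_left (H : HomogeneousGroup E G) (y : E) : H.expMul (0, y) = y := by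
  simp [expMul, H.expMap_zero]

lemma expMul_zero_right (H : HomogeneousGroup E G) (y : E) : H.expMul (y, 0) = y := by
  simp [expMul, H.expMap_zero]

lemma expMul_dilation (H : HomogeneousGroup E G) {l : ℝ} (hl : 0 < l) (x y : E) :
    H.expMul (dilation H.A l x, dilation H.A l y) = dilation H.A l (H.expMul (x, y)) := by
  have h := H.dilation_mul l hl (H.expMap x) (H.expMap y)
  simp only [H.expMap.symm_apply_apply] at h
  refine H.expMap.injective ?_
  change H.expMap _ = H.expMap _
  rw [expMap_expMul, ← h]
  rfl

lemma contDiff_expMul [LieGroup 𝓘(ℝ, E) ∞ G] (H : HomogeneousGroup E G) :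
    ContDiff ℝ ∞ H.expMul := by
  rw [← contMDiff_iff_contDiff]
  have h1 : ContMDiff 𝓘(ℝ, E × E) 𝓘(ℝ, E) ∞ (Prod.fst : E × E → E) := contDiff_fst.contMDiff
  have h2 : ContMDiff 𝓘(ℝ, E × E) 𝓘(ℝ, E) ∞ (Prod.snd : E × E → E) := contDiff_snd.contMDiff
  exact H.expMap.symm.contMDiff.comp
    ((H.expMap.contMDiff.comp h1).mul (H.expMap.contMDiff.comp h2))

end Algebra

section Haar

variable {E G : Type*} [NormedAddCommGroup E] [NormedSpace ℝ E] [FiniteDimensional ℝ E]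
  [TopologicalSpace G] [ChartedSpace E G] [Group G] [LieGroup 𝓘(ℝ, E) ∞ G]
  [MeasurableSpace E] [BorelSpace E]

lemma map_expMul_left (H : HomogeneousGroup E G) (ν : Measure E) [ν.IsAddHaarMeasure] (x : E) :
    ν.map (fun y => H.expMul (x, y)) = ν := by
  obtain ⟨b, v, hb⟩ := H.A_diag
  refine map_eq_self_of_det_fderiv_eq_one ν
    ((H.contDiff_expMul.differentiable (by simp)).comp (by fun_prop)) ?_
    (det_fderiv_eq_one_of_dilation (fun i => (hb i).2) (fun i => (hb i).1) H.contDiff_expMul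
      H.expMul_zero_left (fun l hl x y => H.expMul_dilation hl x y) x)
  exact H.expMap.symm.bijective.comp
    ((Group.mulLeft_bijective (H.expMap x)).comp H.expMap.bijective)

lemma map_expMul_right (H : HomogeneousGroup E G) (ν : Measure E) [ν.IsAddHaarMeasure] (x : E) :
    ν.map (fun y => H.expMul (y, x)) = ν := by
  obtain ⟨b, v, hb⟩ := H.A_diag
  refine map_eq_self_of_det_fderiv_eq_one ν
    ((H.contDiff_expMul.differentiable (by simp)).comp (by fun_prop)) ?_
    (det_fderiv_eq_one_of_dilation (fun i => (hb i).2) (fun i => (hb i).1)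
      (F := fun z => H.expMul (z.2, z.1)) (H.contDiff_expMul.comp (by fun_prop))
      H.expMul_zero_right (fun l hl x y => H.expMul_dilation hl y x) x)
  exact H.expMap.symm.bijective.comp
    ((Group.mulRight_bijective (H.expMap x)).comp H.expMap.bijective)

variable [MeasurableSpace G] [BorelSpace G]

lemma isMulLeftInvariant_map_expMap (H : HomogeneousGroup E G) (ν : Measure E)
    [ν.IsAddHaarMeasure] : (ν.map H.expMap).IsMulLeftInvariant := by
  have : IsTopologicalGroup G := topologicalGroup_of_lieGroup 𝓘(ℝ, E) ∞
  refine ⟨fun g => ?_⟩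
  have hm : Measurable fun y => H.expMul (H.expMap.symm g, y) :=
    (H.contDiff_expMul.continuous.comp (by fun_prop)).measurable
  rw [Measure.map_map (continuous_const_mul g).measurable H.expMap.continuous.measurable]
  conv_rhs => rw [← H.map_expMul_left ν (H.expMap.symm g), Measure.map_map H.expMap.continuous.measurable hm]
  congr 1
  ext y
  simp [expMap_expMul]

lemma isMulRightInvariant_map_expMap (H : HomogeneousGroup E G) (ν : Measure E)
    [ν.IsAddHaarMeasure] : (ν.map H.expMap).IsMulRightInvariant := by
  have : IsTopologicalGroup G := topologicalGroup_of_lieGroup 𝓘(ℝ, E) ∞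
  refine ⟨fun g => ?_⟩
  have hm : Measurable fun y => H.expMul (y, H.expMap.symm g) :=
    (H.contDiff_expMul.continuous.comp (by fun_prop)).measurable
  rw [Measure.map_map (continuous_mul_const g).measurable H.expMap.continuous.measurable]
  conv_rhs => rw [← H.map_expMul_right ν (H.expMap.symm g), Measure.map_map H.expMap.continuous.measurable hm]
  congr 1
  ext y
  simp [expMap_expMul]

lemma isHaarMeasure_map_expMap (H : HomogeneousGroup E G) (ν : Measure E)
    [ν.IsAddHaarMeasure] : (ν.map H.expMap).IsHaarMeasure := by
  have h1 := H.isMulLeftInvariant_map_expMap ν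
  have h2 : (ν.map H.expMap).IsOpenPosMeasure :=
    H.expMap.continuous.isOpenPosMeasure_map H.expMap.surjective
  have h3 : IsFiniteMeasureOnCompacts (ν.map H.expMap) := by
    refine ⟨fun K hK => ?_⟩
    have : ν.map H.expMap K = ν (H.expMap ⁻¹' K) :=
      H.expMap.toHomeomorph.toMeasurableEquiv.map_apply K
    rw [this]
    exact (H.expMap.toHomeomorph.isCompact_preimage.2 hK).measure_lt_top
  exact {}

/-- A Haar measure on a homogeneous group is a multiple of Lebesgue measure in exponential
coordinates. -/
lemma exists_eq_smul_map_expMap (H : HomogeneousGroup E G) (ν : Measure E) [ν.IsAddHaarMeasure]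
    (μ : Measure G) [μ.IsHaarMeasure] : ∃ k : NNReal, μ = k • ν.map H.expMap := by
  have : IsTopologicalGroup G := topologicalGroup_of_lieGroup 𝓘(ℝ, E) ∞
  have : LocallyCompactSpace G := Manifold.locallyCompact_of_finiteDimensional 𝓘(ℝ, E)
  have : SecondCountableTopology G := H.expMap.toHomeomorph.symm.secondCountableTopology
  have := H.isHaarMeasure_map_expMap ν
  exact ⟨_, Measure.isMulLeftInvariant_eq_smul μ (ν.map H.expMap)⟩

end Haar

lemma map_expMap_lt {E G : Type*} [NormedAddCommGroup E] [NormedSpace ℝ E]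
    [FiniteDimensional ℝ E] [TopologicalSpace G] [ChartedSpace E G] [Group G]
    [MeasurableSpace E] [BorelSpace E] [MeasurableSpace G] [BorelSpace G] (H : HomogeneousGroup E G) (ν : Measure E) [ν.IsAddHaarMeasure]
    {N : G → ℝ} (hN : H.IsQuasiNorm N) {r : ℝ} (hr : 0 < r) :
    ν.map H.expMap {x | N x < r} =
      ENNReal.ofReal (r ^ H.Q) * ν.map H.expMap {x | N x < 1} := by
  obtain ⟨b, v, hb⟩ := H.A_diag
  have hA := fun i => (hb i).2
  have hopen : ∀ s, MeasurableSet {x | N x < s} := fun s =>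
    (isOpen_lt hN.continuous continuous_const).measurableSet
  rw [Measure.map_apply H.expMap.continuous.measurable (hopen r),
    Measure.map_apply H.expMap.continuous.measurable (hopen 1)]
  have himg : H.expMap ⁻¹' {x | N x < r} =
      (dilation H.A r : E →ₗ[ℝ] E) '' (H.expMap ⁻¹' {x | N x < 1}) := by
    ext X
    constructor
    · intro (hX : N (H.expMap X) < r)
      refine ⟨dilation H.A r⁻¹ X, ?_, ?_⟩
      · change N (H.expMap (dilation H.A r⁻¹ X)) < 1
        rw [← dil_expMap, hN.dil _ (by positivity), inv_mul_lt_iff₀ hr, mul_one]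
        exact hX
      · change dilation H.A r (dilation H.A r⁻¹ X) = X
        rw [dilation_dilation hA hr (by positivity), mul_inv_cancel₀ hr.ne', dilation_one_apply]
    · rintro ⟨Y, hY, rfl⟩
      have hY : N (H.expMap Y) < 1 := hY
      change N (H.expMap (dilation H.A r Y)) < r
      rw [← dil_expMap, hN.dil _ hr]
      nlinarith
  have hdet := det_dilation hA hr
  rw [himg, Measure.addHaar_image_linearMap]
  rw [ContinuousLinearMap.det] at hdet
  rw [hdet, abs_of_pos (Real.rpow_pos_of_pos hr _)]
  rfl

section QuasiNorm

variable {E G : Type*} [NormedAddCommGroup E] [NormedSpace ℝ E] [FiniteDimensional ℝ E]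
  [TopologicalSpace G] [ChartedSpace E G] [Group G]

lemma isCompact_quasiNorm_le_one (H : HomogeneousGroup E G) {N : G → ℝ} (hN : H.IsQuasiNorm N) :
    IsCompact {x | N x ≤ 1} := by
  have : ProperSpace E := FiniteDimensional.proper ℝ E
  obtain ⟨b, v, hb⟩ := H.A_diag
  have hA := fun i => (hb i).2
  have hcont : Continuous fun X => N (H.expMap X) := hN.continuous.comp H.expMap.continuous
  have hpos : ∀ X : E, X ≠ 0 → 0 < N (H.expMap X) := by
    intro X hX
    refine lt_of_le_of_ne (hN.nonneg _) fun h0 => hX ?_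
    have h1 := (hN.eq_zero_iff _).1 h0.symm
    rw [← H.expMap_zero] at h1
    exact H.expMap.injective h1
  obtain ⟨m, hm0, hm⟩ : ∃ m > 0, ∀ X ∈ Metric.sphere (0 : E) 1, m ≤ N (H.expMap X) := by
    rcases (Metric.sphere (0 : E) 1).eq_empty_or_nonempty with he | hne
    · exact ⟨1, one_pos, by simp [he]⟩
    · obtain ⟨Y, hY, hmin⟩ := (isCompact_sphere (0 : E) 1).exists_isMinOn hne hcont.continuousOn
      refine ⟨_, hpos Y ?_, fun X hX => hmin hX⟩
      rintro rfl
      simp at hY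
  have hlarge : ∀ X : E, 1 < ‖X‖ → m ≤ N (H.expMap X) := by
    intro X hX
    have h0 : ∀ᶠ l in nhdsWithin (0 : ℝ) (Set.Ioi 0), ‖dilation H.A l X‖ < 1 := by
      have := (tendsto_dilation_zero hA (fun i => (hb i).1) X).norm
      rw [norm_zero] at this
      exact this.eventually_lt_const one_pos
    obtain ⟨l, ⟨hl1, hl0, hl2⟩⟩ := (h0.and (Ioo_mem_nhdsGT (one_pos (α := ℝ)))).exists
    have hc : ContinuousOn (fun t => ‖dilation H.A t X‖) (Set.Icc l 1) :=
      ((continuousOn_dilation hA X).mono fun t ht => hl0.trans_le ht.1).norm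
    obtain ⟨t, ht, ht1⟩ := intermediate_value_Icc hl2.le hc
      ⟨hl1.le, by simpa [dilation_one_apply] using hX.le⟩
    have ht0 : 0 < t := hl0.trans_le ht.1
    have h1 := hm (dilation H.A t X) (by simpa using ht1)
    rw [← dil_expMap, hN.dil t ht0] at h1
    nlinarith [ht.2, hN.nonneg (H.expMap X)]
  have hsub : {x | N x ≤ 1} ⊆ H.expMap '' Metric.closedBall 0 ‖dilation H.A (m / 2)⁻¹‖ := by
    intro x (hx : N x ≤ 1)
    refine ⟨H.expMap.symm x, ?_, H.expMap.apply_symm_apply x⟩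
    rw [mem_closedBall_zero_iff]
    set X := H.expMap.symm x with hX
    have hxX : H.expMap X = x := H.expMap.apply_symm_apply x
    have h1 : ‖dilation H.A (m / 2) X‖ ≤ 1 := by
      by_contra hcon
      have h2 := hlarge _ (not_le.1 hcon)
      rw [← dil_expMap, hN.dil _ (by positivity), hxX] at h2
      nlinarith
    calc ‖X‖ = ‖dilation H.A (m / 2)⁻¹ (dilation H.A (m / 2) X)‖ := by
          rw [dilation_dilation hA (by positivity) (by positivity), inv_mul_cancel₀ (by positivity),
            dilation_one_apply]
      _ ≤ ‖dilation H.A (m / 2)⁻¹‖ * 1 := (dilation H.A (m / 2)⁻¹).le_opNorm_of_le h1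
      _ = _ := mul_one _
  exact ((isCompact_closedBall _ _).image H.expMap.continuous).of_isClosed_subset
    (isClosed_le hN.continuous continuous_const) hsub

lemma exists_quasiNorm_mul_le [IsTopologicalGroup G] (H : HomogeneousGroup E G) {N : G → ℝ}
    (hN : H.IsQuasiNorm N) : ∃ K : ℝ, 1 ≤ K ∧ ∀ x y, N (x * y) ≤ K * max (N x) (N y) := by
  have hc := H.isCompact_quasiNorm_le_one hN
  obtain ⟨K₀, hK₀⟩ := ((hc.prod hc).image
    (hN.continuous.comp continuous_mul)).bddAbove
  have hK : ∀ x y, N x ≤ 1 → N y ≤ 1 → N (x * y) ≤ max 1 K₀ := fun x y hx hy =>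
    (hK₀ ⟨(x, y), ⟨hx, hy⟩, rfl⟩).trans (le_max_right _ _)
  refine ⟨max 1 K₀, le_max_left _ _, fun x y => ?_⟩
  have hs : 0 ≤ max (N x) (N y) := (hN.nonneg x).trans (le_max_left _ _)
  rcases hs.eq_or_lt with h0 | h0
  · have hx : x = 1 := (hN.eq_zero_iff x).1
      (le_antisymm ((le_max_left _ _).trans h0.ge) (hN.nonneg x))
    have hy : y = 1 := (hN.eq_zero_iff y).1
      (le_antisymm ((le_max_right _ _).trans h0.ge) (hN.nonneg y))
    rw [← h0, hx, hy, mul_one, (hN.eq_zero_iff 1).2 rfl, mul_zero]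
  · set s := max (N x) (N y) with hsdef
    have hs' : 0 < s⁻¹ := inv_pos.2 h0
    have hx : N (H.dil s⁻¹ x) ≤ 1 := by
      rw [hN.dil _ hs', inv_mul_le_iff₀ h0, mul_one]
      exact le_max_left _ _
    have hy : N (H.dil s⁻¹ y) ≤ 1 := by
      rw [hN.dil _ hs', inv_mul_le_iff₀ h0, mul_one]
      exact le_max_right _ _
    have h1 := hK _ _ hx hy
    have h2 : H.dil s⁻¹ x * H.dil s⁻¹ y = H.dil s⁻¹ (x * y) := (H.dilation_mul _ hs' x y).symm
    rw [h2, hN.dil _ hs', inv_mul_le_iff₀ h0] at h1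
    linarith

end QuasiNorm

/-- The quasi-distance on a homogeneous group of positive dimension is Ahlfors regular of
dimension `Q` with respect to a Haar measure. -/
lemma exists_isRegularQuasiMetric {E G : Type*} [NormedAddCommGroup E] [NormedSpace ℝ E]
    [FiniteDimensional ℝ E] [TopologicalSpace G] [ChartedSpace E G] [Group G]
    [LieGroup 𝓘(ℝ, E) ∞ G] [MeasurableSpace G] [BorelSpace G] (H : HomogeneousGroup E G)
    (μ : Measure G) [μ.IsHaarMeasure] {N : G → ℝ} (hN : H.IsQuasiNorm N) (hQ : 0 < H.Q) :
    ∃ K c, IsRegularQuasiMetric μ (fun x y => N (x * y⁻¹)) H.Q K c := by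
  have : IsTopologicalGroup G := topologicalGroup_of_lieGroup 𝓘(ℝ, E) ∞
  have : SecondCountableTopology G := H.expMap.toHomeomorph.symm.secondCountableTopology
  obtain ⟨K, hK1, hK⟩ := H.exists_quasiNorm_mul_le hN
  have hsymm : ∀ x y, N (x * y⁻¹) = N (y * x⁻¹) := fun x y => by
    rw [← hN.inv (x * y⁻¹), mul_inv_rev, inv_inv]
  refine ⟨K, μ {x | N x < 1}, ?_, fun x y => hN.nonneg _, fun x => ?_, hsymm, fun x y z => ?_,
    hK1, hQ, ?_, ?_, fun x r hr => ?_⟩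
  · exact (hN.continuous.comp (by fun_prop : Continuous fun z : G × G => z.1 * z.2⁻¹)).measurable
  · rw [mul_inv_cancel, (hN.eq_zero_iff 1).2 rfl]
  · have := hK (x * y⁻¹) (y * z⁻¹)
    rwa [mul_assoc, inv_mul_cancel_left] at this
  · refine (IsOpen.measure_pos μ (isOpen_lt hN.continuous continuous_const) ⟨1, ?_⟩).ne'
    change N 1 < 1
    rw [(hN.eq_zero_iff 1).2 rfl]
    exact one_pos
  · exact ((measure_mono fun x (hx : N x < 1) => hx.le).trans_lt
      (H.isCompact_quasiNorm_le_one hN).measure_lt_top).ne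
  · let _ : MeasurableSpace E := borel E
    have : BorelSpace E := ⟨rfl⟩
    let ν : Measure E := Measure.addHaar
    obtain ⟨k, hk⟩ := H.exists_eq_smul_map_expMap ν μ
    have hr' := H.isMulRightInvariant_map_expMap ν
    have hball : distBall (fun x y => N (x * y⁻¹)) x r = (fun y => y * x⁻¹) ⁻¹' {y | N y < r} := by
      ext y
      change N (x * y⁻¹) < r ↔ N (y * x⁻¹) < r
      rw [hsymm]
    rw [hball, hk, Measure.smul_apply, Measure.smul_apply, measure_preimage_mul_right,
      H.map_expMap_lt ν hN hr, ENNReal.smul_def, ENNReal.smul_def, smul_eq_mul, smul_eq_mul]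
    ring

end HomogeneousGroup

section Morrey

variable {G : Type*} [Group G] [MeasurableSpace G] {μ : Measure G} {N : G → ℝ} {Q p : ℝ}
  {φ : ℝ → ℝ}

lemma morreyNorm_le_iff (hp : 0 < p) (hφ : ∀ r, 0 < r → 0 < φ r) {f : G → ℂ} {b : ℝ≥0∞} :
    morreyNorm μ N Q p φ f ≤ b ↔
      MorreyBound μ (fun x y => N (x * y⁻¹)) Q p φ (fun y => ‖f y‖ₑ) b := by
  simp only [morreyNorm, iSup_le_iff, MorreyBound]
  refine forall_congr' fun x => forall_congr' fun r => forall_congr' fun hr => ?_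
  have hφr := hφ r hr
  have hrQ : 0 < r ^ Q := Real.rpow_pos_of_pos hr Q
  set I := ∫⁻ y in quasiBall N x r, ‖f y‖ₑ ^ p ∂μ with hI
  have hone : ∀ {a : ℝ}, 0 < a → ENNReal.ofReal (1 / a) = (ENNReal.ofReal a)⁻¹ := fun ha => by
    rw [one_div, ENNReal.ofReal_inv_of_pos ha]
  have hφ0 : ENNReal.ofReal (φ r) ≠ 0 := (ENNReal.ofReal_pos.2 hφr).ne'
  have hQ0 : ENNReal.ofReal (r ^ Q) ≠ 0 := (ENNReal.ofReal_pos.2 hrQ).ne'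
  rw [hone hφr, hone hrQ, ENNReal.inv_mul_le_iff hφ0 ENNReal.ofReal_ne_top, one_div,
    ENNReal.rpow_inv_le_iff hp, ENNReal.inv_mul_le_iff hQ0 ENNReal.ofReal_ne_top,
    ENNReal.mul_rpow_of_nonneg _ _ hp.le, ENNReal.ofReal_rpow_of_pos hφr, ← mul_assoc,
    ← ENNReal.ofReal_mul hrQ.le]
  rfl

end Morrey

section Fractional

variable {G : Type*} [Group G] {N : G → ℝ} {Q : ℝ} {ρ : ℝ → ℝ}

lemma fracKernel_nonneg (hN : ∀ x, 0 ≤ N x) (hQ : 0 < Q)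
    (hρ : Set.MapsTo ρ (Set.Ioi 0) (Set.Ioi 0)) (x y : G) : 0 ≤ fracKernel N Q ρ x y := by
  rw [fracKernel]
  rcases (hN (x * y⁻¹)).eq_or_lt with h0 | h0
  · simp [← h0, Real.zero_rpow hQ.ne']
  · have : 0 < ρ (N (x * y⁻¹)) := hρ h0
    positivity

lemma fracKernel_indicator (hN : ∀ x, 0 ≤ N x) (hQ : 0 < Q) :
    fracKernel N Q ((Set.Ioi 0).indicator ρ) = fracKernel N Q ρ := by
  ext x y
  rw [fracKernel, fracKernel]
  rcases (hN (x * y⁻¹)).eq_or_lt with h0 | h0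
  · simp [← h0, Real.zero_rpow hQ.ne']
  · rw [Set.indicator_of_mem (show N (x * y⁻¹) ∈ Set.Ioi 0 from h0)]

lemma enorm_fracKernel_mul (hN : ∀ x, 0 ≤ N x) (hQ : 0 < Q)
    (hρ : Set.MapsTo ρ (Set.Ioi 0) (Set.Ioi 0)) (x y : G) (z : ℂ) :
    ‖(fracKernel N Q ρ x y : ℂ) * z‖ₑ =
      ENNReal.ofReal (ρ (N (x * y⁻¹)) / N (x * y⁻¹) ^ Q) * ‖z‖ₑ := by
  rw [enorm_mul]
  congr 1
  rw [← ofReal_norm, Complex.norm_real, Real.norm_of_nonneg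
    (fracKernel_nonneg hN hQ hρ x y)]
  rfl

end Fractional

lemma Doubling.indicator {C : ℝ} {ρ : ℝ → ℝ} (h : Doubling C ρ) :
    Doubling C ((Set.Ioi 0).indicator ρ) := by
  intro r s hr hs h1 h2
  rw [Set.indicator_of_mem (show r ∈ Set.Ioi 0 from hr),
    Set.indicator_of_mem (show s ∈ Set.Ioi 0 from hs)]
  exact h r s hr hs h1 h2

lemma measurable_indicator_Ioi {ρ : ℝ → ℝ} (h : Measurable fun t : Set.Ioi (0 : ℝ) => ρ t) :
    Measurable ((Set.Ioi 0).indicator ρ) := by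
  refine measurable_of_restrict_of_restrict_compl (s := Set.Ioi 0) measurableSet_Ioi ?_ ?_
  · convert h using 1
    ext t
    exact Set.indicator_of_mem t.2 ρ
  · convert measurable_const (a := (0 : ℝ)) using 1
    ext t
    exact Set.indicator_of_notMem t.2 ρ

/-- The boundedness of the fractional integral for a globally measurable `ρ`, given the estimate
for nonnegative functions. -/
lemma fracIntegral_morrey {G : Type*} [Group G] [TopologicalSpace G] [IsTopologicalGroup G]
    [SecondCountableTopology G] [LocallyCompactSpace G] [MeasurableSpace G] [BorelSpace G]
    {μ : Measure G} [SFinite μ] {N : G → ℝ} (hNc : Continuous N) {Q K : ℝ} {c : ℝ≥0∞}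
    (h : IsRegularQuasiMetric μ (fun x y => N (x * y⁻¹)) Q K c) {p q : ℝ} (hp : 0 < p)
    (hq : 0 < q) {φ ψ ρ : ℝ → ℝ} (hφ : ∀ r, 0 < r → 0 < φ r) (hψ : ∀ r, 0 < r → 0 < ψ r)
    (hρm : Measurable ρ) (hρ : Set.MapsTo ρ (Set.Ioi 0) (Set.Ioi 0)) {C : ℝ≥0∞} (hC : C ≠ ⊤)
    (hbound : ∀ (g : G → ℝ≥0∞) (b : ℝ≥0∞), Measurable g →
      MorreyBound μ (fun x y => N (x * y⁻¹)) Q p φ g b → b ≠ ⊤ →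
      MorreyBound μ (fun x y => N (x * y⁻¹)) Q q ψ
        (fracLIntegral μ (fun x y => N (x * y⁻¹)) Q ρ g) (C * b))
    {f : G → ℂ} (hf : MemMorrey μ N Q p φ f) :
    (∀ᵐ x ∂μ, Integrable (fun y => (fracKernel N Q ρ x y : ℂ) * f y) μ) ∧
      MemMorrey μ N Q q ψ (fracIntegral μ N Q ρ f) ∧
      morreyNorm μ N Q q ψ (fracIntegral μ N Q ρ f) ≤ C * morreyNorm μ N Q p φ f := by
  set d : G → G → ℝ := fun x y => N (x * y⁻¹) with hd
  have hN0 : ∀ x, 0 ≤ N x := fun x => by simpa [hd] using h.nonneg x 1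
  have hdc : Continuous fun z : G × G => N (z.1 * z.2⁻¹) := hNc.comp (by fun_prop)
  have hkm : Measurable fun z : G × G => fracKernel N Q ρ z.1 z.2 :=
    (hρm.comp hdc.measurable).div (hdc.measurable.pow_const Q)
  have hfm : AEStronglyMeasurable f μ := by
    rw [← Measure.restrict_univ (μ := μ), ← iUnion_compactCovering G,
      aestronglyMeasurable_iUnion_iff]
    exact fun n => (hf.1 _ (isCompact_compactCovering G n)).1
  set f' := hfm.mk f with hf'
  have hff' : f =ᵐ[μ] f' := hfm.ae_eq_mk
  have hf'm : StronglyMeasurable f' := hfm.stronglyMeasurable_mk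
  set g : G → ℝ≥0∞ := fun y => ‖f' y‖ₑ with hg
  have hgm : Measurable g := hf'm.measurable.enorm
  set b := morreyNorm μ N Q p φ f with hb
  have hbtop : b ≠ ⊤ := hf.2.ne
  have hgb : MorreyBound μ d Q p φ g b := by
    intro x r hr
    refine le_of_eq_of_le ?_ ((morreyNorm_le_iff hp hφ).1 hb.ge x r hr)
    refine lintegral_congr_ae (ae_restrict_of_ae ?_)
    filter_upwards [hff'] with y hy
    rw [hg, hy]
  set S := fracLIntegral μ d Q ρ g with hS
  have hSm : Measurable S := by
    refine Measurable.lintegral_prod_right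
      (f := fun x y => ENNReal.ofReal (ρ (d x y) / d x y ^ Q) * g y) ?_
    exact hkm.ennreal_ofReal.mul (hgm.comp measurable_snd)
  have hSb : MorreyBound μ d Q q ψ S (C * b) := hbound g b hgm hgb hbtop
  have hSf : ∀ x, ∫⁻ y, ‖(fracKernel N Q ρ x y : ℂ) * f y‖ₑ ∂μ = S x := by
    intro x
    refine lintegral_congr_ae ?_
    filter_upwards [hff'] with y hy
    rw [enorm_fracKernel_mul hN0 h.dim_pos hρ, hy]
  have hTS : ∀ x, ‖fracIntegral μ N Q ρ f x‖ₑ ≤ S x := fun x =>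
    (enorm_integral_le_lintegral_enorm _).trans (hSf x).le
  have hTb : MorreyBound μ d Q q ψ (fun x => ‖fracIntegral μ N Q ρ f x‖ₑ) (C * b) :=
    fun x r hr => (lintegral_mono fun y => ENNReal.rpow_le_rpow (hTS y) hq.le).trans (hSb x r hr)
  have hfin : ∀ r, ENNReal.ofReal (r ^ Q * ψ r ^ q) * (C * b) ^ q < ⊤ := fun r =>
    ENNReal.mul_lt_top ENNReal.ofReal_lt_top
      (ENNReal.rpow_lt_top_of_nonneg hq.le (ENNReal.mul_ne_top hC hbtop))
  have hT := (morreyNorm_le_iff hq hψ).2 hTb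
  refine ⟨?_, ⟨fun K hK => ⟨?_, ?_⟩, hT.trans_lt (ENNReal.mul_lt_top hC.lt_top hf.2)⟩, hT⟩
  · have hU : ⋃ n : ℕ, distBall d 1 (n + 1) = Set.univ := by
      refine Set.eq_univ_of_forall fun y => Set.mem_iUnion.2 ?_
      obtain ⟨n, hn⟩ := exists_nat_gt (d 1 y)
      exact ⟨n, show d 1 y < n + 1 by linarith⟩
    have hSfin : ∀ᵐ x ∂μ, S x < ⊤ := by
      rw [← Measure.restrict_univ (μ := μ), ← hU, ae_restrict_iUnion_iff]
      intro n
      have hlt := (hSb 1 (n + 1) (by positivity)).trans_lt (hfin _)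
      filter_upwards [ae_lt_top (hSm.pow_const q) hlt.ne] with x hx
      rw [lt_top_iff_ne_top] at hx ⊢
      rintro hx'
      exact hx (by rw [hx', ENNReal.top_rpow_of_pos hq])
    filter_upwards [hSfin] with x hx
    refine ⟨?_, ?_⟩
    · exact (Complex.measurable_ofReal.comp
        (hkm.comp measurable_prodMk_left)).aestronglyMeasurable.mul hfm
    · rw [HasFiniteIntegral, hSf]
      exact hx
  · have hTf' : fracIntegral μ N Q ρ f = fun x => ∫ y, (fracKernel N Q ρ x y : ℂ) * f' y ∂μ := by
      ext x
      refine integral_congr_ae ?_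
      filter_upwards [hff'] with y hy
      rw [hy]
    rw [hTf']
    refine StronglyMeasurable.aestronglyMeasurable ?_
    refine StronglyMeasurable.integral_prod_right'
      (f := fun z : G × G => (fracKernel N Q ρ z.1 z.2 : ℂ) * f' z.2) ?_
    exact ((Complex.measurable_ofReal.comp hkm).mul
      (hf'm.measurable.comp measurable_snd)).stronglyMeasurable
  · have hq' : ENNReal.ofReal q ≠ 0 := (ENNReal.ofReal_pos.2 hq).ne'
    rw [eLpNorm_lt_top_iff_lintegral_rpow_enorm_lt_top hq' ENNReal.ofReal_ne_top,
      ENNReal.toReal_ofReal hq.le]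
    obtain ⟨R, hR⟩ := (hK.image (f := fun y => N (1 * y⁻¹)) (hNc.comp (by fun_prop))).bddAbove
    have hsub : K ⊆ distBall d 1 (max R 0 + 1) := by
      intro y hy
      have h1 : N (1 * y⁻¹) ≤ R := hR ⟨y, hy, rfl⟩
      change N (1 * y⁻¹) < max R 0 + 1
      linarith [le_max_left R 0]
    exact (lintegral_mono_set hsub).trans_lt
      ((hTb 1 _ (by positivity)).trans_lt (hfin _))

/-- Over a one-point group only the zero function lies in the Morrey space when `φ` takes
arbitrarily small values. -/
lemma MemMorrey.ae_eq_zero_of_subsingleton {G : Type*} [Group G] [TopologicalSpace G]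
    [MeasurableSpace G] [Subsingleton G] {μ : Measure G} {N : G → ℝ} (hN : N 1 = 0) {p : ℝ}
    (hp : 0 < p) {φ : ℝ → ℝ} (hφ : ∀ r, 0 < r → 0 < φ r)
    (hφs : Set.SurjOn φ (Set.Ioi 0) (Set.Ioi 0)) {f : G → ℂ} (hf : MemMorrey μ N 0 p φ f) :
    f =ᵐ[μ] 0 := by
  have hb := (morreyNorm_le_iff hp hφ).1 (le_refl (morreyNorm μ N 0 p φ f))
  set b := morreyNorm μ N 0 p φ f
  have hball : ∀ r : ℝ, 0 < r → distBall (fun x y => N (x * y⁻¹)) 1 r = Set.univ := by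
    intro r hr
    refine Set.eq_univ_of_forall fun y => ?_
    change N (1 * y⁻¹) < r
    rwa [Subsingleton.elim (1 * y⁻¹) 1, hN]
  have hle : ∀ ε : NNReal, 0 < ε → ∫⁻ y, ‖f y‖ₑ ^ p ∂μ ≤ ε * b ^ p := by
    intro ε hε
    obtain ⟨r, hr, hφr⟩ := hφs (show (ε : ℝ) ^ (1 / p) ∈ Set.Ioi 0 from
      Real.rpow_pos_of_pos (NNReal.coe_pos.2 hε) _)
    have h1 := hb 1 r hr
    rw [hball r hr, setLIntegral_univ, hφr, Real.rpow_zero, one_mul, ← Real.rpow_mul ε.coe_nonneg,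
      one_div_mul_cancel hp.ne', Real.rpow_one, ENNReal.ofReal_coe_nnreal] at h1
    exact h1
  have hbp : b ^ p ≠ ⊤ := ENNReal.rpow_ne_top_of_nonneg hp.le hf.2.ne
  have h0 : ∫⁻ y, ‖f y‖ₑ ^ p ∂μ = 0 := by
    by_contra hne
    obtain ⟨ε, hε, hlt⟩ := ENNReal.exists_nnreal_pos_mul_lt hbp hne
    exact absurd (hle ε hε) (not_le.2 hlt)
  have hm : Measurable fun y => ‖f y‖ₑ ^ p := by
    have : f = fun _ => f 1 := funext fun y => by rw [Subsingleton.elim y 1]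
    rw [this]
    fun_prop
  rw [lintegral_eq_zero_iff hm] at h0
  filter_upwards [h0] with y hy
  have hy' : ‖f y‖ₑ ^ p = 0 := hy
  rwa [ENNReal.rpow_eq_zero_iff_of_pos hp, enorm_eq_zero] at hy'

theorem theorem6p1 {E G : Type*} [NormedAddCommGroup E] [NormedSpace ℝ E] [FiniteDimensional ℝ E]
    [TopologicalSpace G] [ChartedSpace E G] [Group G] [LieGroup 𝓘(ℝ, E) ∞ G]
    [ConnectedSpace G] [SimplyConnectedSpace G] [MeasurableSpace G] [BorelSpace G]
    (H : HomogeneousGroup E G) (μ : Measure G) [μ.IsHaarMeasure]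
    (N : G → ℝ) (hN : H.IsQuasiNorm N)
    (p q : ℝ) (hp : 1 < p) (hpq : p < q)
    (φ : ℝ → ℝ) (hφ_meas : Measurable (fun t : Set.Ioi (0 : ℝ) => φ t))
    (hφ_maps : Set.MapsTo φ (Set.Ioi 0) (Set.Ioi 0))
    (hφ_surj : Set.SurjOn φ (Set.Ioi 0) (Set.Ioi 0))
    (Cφ : ℝ) (hφ_doubling : Doubling Cφ φ)
    (C₁ : ℝ) (hφ_int : ∀ r : ℝ, 0 < r →
      ∫⁻ t in Set.Ioi r, ENNReal.ofReal (φ t ^ p / t) ≤ ENNReal.ofReal (C₁ * φ r ^ p))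
    (Cρ C₂ : ℝ) :
    ∃ C : ℝ, 0 < C ∧ ∀ ρ : ℝ → ℝ, Measurable (fun t : Set.Ioi (0 : ℝ) => ρ t) →
      Set.MapsTo ρ (Set.Ioi 0) (Set.Ioi 0) → Doubling Cρ ρ →
      (∀ r : ℝ, 0 < r →
        ENNReal.ofReal (φ r) * (∫⁻ t in Set.Ioo 0 r, ENNReal.ofReal (ρ t / t)) +
          (∫⁻ t in Set.Ioi r, ENNReal.ofReal (ρ t * φ t / t)) ≤
            ENNReal.ofReal (C₂ * φ r ^ (p / q))) →
      ∀ f : G → ℂ, MemMorrey μ N H.Q p φ f →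
        (∀ᵐ x ∂μ, Integrable (fun y => (fracKernel N H.Q ρ x y : ℂ) * f y) μ) ∧
        MemMorrey μ N H.Q q (fun r => φ r ^ (p / q)) (fracIntegral μ N H.Q ρ f) ∧
        morreyNorm μ N H.Q q (fun r => φ r ^ (p / q)) (fracIntegral μ N H.Q ρ f) ≤
          ENNReal.ofReal C * morreyNorm μ N H.Q p φ f := by
  have hp0 : 0 < p := by linarith
  have hq0 : 0 < q := by linarith
  have hφ : ∀ r, 0 < r → 0 < φ r := fun r hr => hφ_maps hr
  have hψ : ∀ r, 0 < r → 0 < φ r ^ (p / q) := fun r hr => Real.rpow_pos_of_pos (hφ r hr) _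
  have : IsTopologicalGroup G := topologicalGroup_of_lieGroup 𝓘(ℝ, E) ∞
  have : LocallyCompactSpace G := Manifold.locallyCompact_of_finiteDimensional 𝓘(ℝ, E)
  have : SecondCountableTopology G := H.expMap.toHomeomorph.symm.secondCountableTopology
  rcases subsingleton_or_nontrivial E with hE | hE
  · have hG : Subsingleton G := H.expMap.symm.injective.subsingleton
    have hQ : H.Q = 0 := by
      rw [HomogeneousGroup.Q, Subsingleton.elim (H.A : E →ₗ[ℝ] E) 0, map_zero]
    refine ⟨1, one_pos, fun ρ _ _ _ _ f hf => ?_⟩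
    rw [hQ] at hf ⊢
    have hf0 : f =ᵐ[μ] 0 :=
      hf.ae_eq_zero_of_subsingleton ((hN.eq_zero_iff 1).2 rfl) hp0 hφ hφ_surj
    have hk : ∀ x, (fun y => (fracKernel N 0 ρ x y : ℂ) * f y) =ᵐ[μ] 0 := fun x => by
      filter_upwards [hf0] with y hy
      simp [hy]
    have hT : fracIntegral μ N 0 ρ f = 0 := by
      ext x
      rw [fracIntegral, integral_congr_ae (hk x)]
      simp
    have hnorm : morreyNorm μ N 0 q (fun r => φ r ^ (p / q)) (0 : G → ℂ) ≤ 0 := by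
      rw [morreyNorm_le_iff hq0 hψ]
      intro x r hr
      simp [hq0]
    rw [hT]
    exact ⟨Filter.Eventually.of_forall fun x => (integrable_zero G ℂ μ).congr (hk x).symm,
      ⟨fun K _ => MemLp.zero, hnorm.trans_lt ENNReal.zero_lt_top⟩, hnorm.trans bot_le⟩
  · have hQ : 0 < H.Q := by
      obtain ⟨b, v, hb⟩ := H.A_diag
      have : Nonempty (Fin (Module.finrank ℝ E)) := ⟨⟨0, Module.finrank_pos⟩⟩
      rw [HomogeneousGroup.Q, trace_eq_sum_eigenvalues fun i => (hb i).2]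
      exact Finset.sum_pos (fun i _ => (hb i).1) Finset.univ_nonempty
    obtain ⟨K, c, h⟩ := H.exists_isRegularQuasiMetric μ hN hQ
    obtain ⟨C, hC, hmain⟩ := h.exists_fracLIntegral_morreyBound hp hpq hφ_maps hφ_surj
      hφ_doubling hφ_int Cρ C₂
    refine ⟨C.toReal + 1, by positivity, fun ρ hρm hρ hd hint f hf => ?_⟩
    have hind : ∀ t : ℝ, 0 < t → (Set.Ioi 0).indicator ρ t = ρ t := fun t ht =>
      Set.indicator_of_mem ht ρ
    have hρ' : Set.MapsTo ((Set.Ioi 0).indicator ρ) (Set.Ioi 0) (Set.Ioi 0) := fun t ht => by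
      rw [hind t ht]
      exact hρ ht
    have hint' : ∀ r : ℝ, 0 < r →
        ENNReal.ofReal (φ r) *
            (∫⁻ t in Set.Ioo 0 r, ENNReal.ofReal ((Set.Ioi 0).indicator ρ t / t)) +
          (∫⁻ t in Set.Ioi r, ENNReal.ofReal ((Set.Ioi 0).indicator ρ t * φ t / t)) ≤
            ENNReal.ofReal (C₂ * φ r ^ (p / q)) := by
      intro r hr
      have e₀ : ∫⁻ t in Set.Ioo 0 r, ENNReal.ofReal ((Set.Ioi 0).indicator ρ t / t) =
          ∫⁻ t in Set.Ioo 0 r, ENNReal.ofReal (ρ t / t) :=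
        setLIntegral_congr_fun measurableSet_Ioo fun t ht => by simp only [hind t ht.1]
      have e₁ : ∫⁻ t in Set.Ioi r, ENNReal.ofReal ((Set.Ioi 0).indicator ρ t * φ t / t) =
          ∫⁻ t in Set.Ioi r, ENNReal.ofReal (ρ t * φ t / t) :=
        setLIntegral_congr_fun measurableSet_Ioi fun t ht => by simp only [hind t (hr.trans ht)]
      rw [e₀, e₁]
      exact hint r hr
    have hρm' := measurable_indicator_Ioi hρm
    have key := fracIntegral_morrey hN.continuous h hp0 hq0 hφ hψ hρm' hρ' hC
      (hmain _ hρm' hρ' hd.indicator hint') hf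
    have hT : fracIntegral μ N H.Q ((Set.Ioi 0).indicator ρ) f = fracIntegral μ N H.Q ρ f := by
      ext x
      simp only [fracIntegral, fracKernel_indicator hN.nonneg hQ]
    rw [hT, fracKernel_indicator hN.nonneg hQ] at key
    refine ⟨key.1, key.2.1, key.2.2.trans ?_⟩
    gcongr
    rw [ENNReal.le_ofReal_iff_toReal_le hC (by positivity)]
    linarith
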